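/- For $\lambda\in\mathbb{C}$, $n\ge 0$, $t\in\mathbb{C}^{n+1}$ and $s\in\mathbb{C}^{n}$ put $$W_n(\lambda;s)=\prod_{1\le j<k\le n}[4\sinh^2(s_j-s_k)]^{\lambda},\qquad \mathcal{K}^\sharp_{n+1}(\lambda;t,s)=\prod_{j=1}^{n+1}\prod_{k=1}^{n}[2\cosh(t_j-s_k)]^{-\lambda},$$ with principal powers. For $v\in\mathbb{C}^N$ let $V_N=\frac1N\sum_{j}v_j$, $v^{(N)}_j=v_j-V_N$; in particular this defines $T_N,U_N,t^{(N)},u^{(N)}$ for $t,u\in\mathbb{C}^N$. Let $\phi_N(t)=\frac12(\max_j\operatorname{Im}t_j+\min_j\operatorname{Im}t_j)$, $\mu_N(t)=\max_j|\operatorname{Im}t^{(N)}_j|$ and $\mathcal{A}_N^r=\{t\in\mathbb{C}^N:\mu_N(t)<\pi/2\}$. Define $F_1(\lambda;t,u)=e^{itu}$ and, for $N\ge2$, $$F_N(\lambda;t,u)=\frac{e^{iu_N(t_1+\cdots+t_N)}}{(N-1)!}\int_{(\mathbb{R}+i\phi_N(t))^{N-1}}W_{N-1}(\lambda;s)\,\mathcal{K}^\sharp_N(\lambda;t,s)\,F_{N-1}\big(\lambda;s,(u_1-u_N,\ldots,u_{N-1}-u_N)\big)\,ds,$$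 so that the integral is over $\mathbb{R}^{N-1}$ when $t$ is real. Let $$\mathcal{D}_N=\{(\lambda,t,u)\in\mathbb{C}\times\mathcal{A}_N^r\times\mathbb{C}^N:\operatorname{Re}\lambda>1,\ |\operatorname{Im}(u_j-u_k)|<2\operatorname{Re}\lambda\ \text{for all }j,k\},$$ and let $\widehat{\mathcal{D}}_N$ be the set defined by the same conditions with $\operatorname{Re}\lambda\ge1$ in place of $\operatorname{Re}\lambda>1$. **Theorem 6.4.** Let $N\ge1$. (a) For $(\lambda,t,u)\in\widehat{\mathcal{D}}_N$ the integral defining $F_N$ and the integral in $$F_N^r(\lambda;t,u)=\frac1{(N-1)!}\int_{\mathbb{R}^{N-1}}W_{N-1}(\lambda;s)\,\mathcal{K}^\sharp_N(\lambda;t^{(N)},s)\,F_{N-1}\big(\lambda;s,(u_1-u_N,\ldots,u_{N-1}-u_N)\big)\,ds$$ converge absolutely, and $F_N(\lambda;t,u)=\exp(iN\,T_NU_N)\,F_N^r(\lambda;t,u)$. (For $N=1$ read $F_1^r=1$, with no convergence condition.) (b) $F_N$ is holomorphic on $\mathcal{D}_N$ and continuous on $\widehat{\mathcal{D}}_N$.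 (c) There is a real function $C$, continuous on $\{\lambda\in\mathbb{C}:\operatorname{Re}\lambda\ge1\}\times[0,\pi/2)$, such that for all $\lambda$ with $\operatorname{Re}\lambda\ge1$, all $t\in\mathcal{A}_N^r$ with $\operatorname{Re}(t_j-t_k)\ne0$ and all $u\in\mathbb{C}^N$ with $0<|\operatorname{Im}(u_j-u_k)|<2\operatorname{Re}\lambda$ (for $1\le j<k\le N$), $$|F_N(\lambda;t,u)|<C(\lambda,\mu_N(t))\,e^{-N\operatorname{Im}(T_NU_N)}\;\frac{\displaystyle\sum_{\tau\in S_N}(-1)^{\tau}\exp\Big(-\sum_{j=1}^N\operatorname{Re}\big(t^{(N)}_{\tau(j)}\big)\operatorname{Im}\big(u^{(N)}_j\big)\Big)}{\displaystyle\prod_{1\le j<k\le N}\sin\Big(\frac{\pi\operatorname{Im}(u_k-u_j)}{2\operatorname{Re}\lambda}\Big)\sinh\big(\operatorname{Re}\lambda\,\operatorname{Re}(t_j-t_k)\big)},$$ where $(-1)^\tau$ denotes the sign of $\tau$. -/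

import Mathlib

noncomputable section

namespace CalogeroMoser

/-- The weight function `W_n(lam; s) = ∏_{j<k} [4 sinh²(s_j - s_k)]^lam`.
It is only evaluated at `s` with real differences, where the base is a nonnegative real. -/
def weight {n : ℕ} (lam : ℂ) (s : Fin n → ℂ) : ℂ :=
  ∏ j, ∏ k ∈ Finset.Ioi j, (4 * Complex.sinh (s j - s k) ^ 2) ^ lam

/-- The kernel function `K(lam; t, s) = ∏_j ∏_k [2 cosh(t_j - s_k)]^(-lam)`, with `n + 1`
variables `t` and `n` variables `s`. For `|Im (t_j - s_k)| < π/2` the base has positive real part,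
so the principal power is the continuation of the positive power from real arguments. -/
def kernel {n : ℕ} (lam : ℂ) (t : Fin (n + 1) → ℂ) (s : Fin n → ℂ) : ℂ :=
  ∏ j, ∏ k, (2 * Complex.cosh (t j - s k)) ^ (-lam)

/-- The point of the shifted contour `(ℝ + i c)^n` with real parts `s`. -/
def contour {n : ℕ} (c : ℝ) (s : Fin n → ℝ) : Fin n → ℂ :=
  fun j => (s j : ℂ) + Complex.I * (c : ℂ)

/-- Half the sum of the largest and the smallest of the imaginary parts of `t_1, …, t_N`. -/
def midHeight {N : ℕ} (t : Fin N → ℂ) : ℝ :=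
  ((⨆ j, (t j).im) + ⨅ j, (t j).im) / 2

/-- The integrand of one recursion step, parametrized over `(ℝ + i c)^n`: weight, times kernel,
times the function `G` of `n` variables at spectral parameters
`(u_1 - u_{n+1}, …, u_n - u_{n+1})`. -/
def stepIntegrand {n : ℕ} (G : (Fin n → ℂ) → (Fin n → ℂ) → ℂ) (lam : ℂ)
    (t u : Fin (n + 1) → ℂ) (c : ℝ) (s : Fin n → ℝ) : ℂ :=
  weight lam (contour c s) * kernel lam t (contour c s) *
    G (contour c s) (fun j => u j.castSucc - u (Fin.last n))

/-- The function `F_N(lam; t, u)`, defined recursively in `N`. For real `t` the contour is `ℝ^n`;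
for general `t` it is shifted to the height `midHeight t`. Starting at `N = 0` with the
constant `1` gives `F_1(t, u) = exp(i t u)`, the integral over `ℝ^0` being evaluation at a point. -/
def F : (N : ℕ) → ℂ → (Fin N → ℂ) → (Fin N → ℂ) → ℂ
  | 0, _, _, _ => 1
  | n + 1, lam, t, u =>
      Complex.exp (Complex.I * u (Fin.last n) * ∑ j, t j) / (n.factorial : ℂ) *
        ∫ s : Fin n → ℝ, stepIntegrand (F n lam) lam t u (midHeight t) s

/-- The mean `V_N` of the entries of a vector `v`. -/
def mean {N : ℕ} (v : Fin N → ℂ) : ℂ := (∑ j, v j) / (N : ℂ)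

/-- The vector `v^{(N)}` with entries `v_j - V_N`. -/
def relative {N : ℕ} (v : Fin N → ℂ) : Fin N → ℂ := fun j => v j - mean v

/-- The maximum `μ_N(t)` of the `|Im t^{(N)}_j|`. -/
def maxIm {N : ℕ} (t : Fin N → ℂ) : ℝ := ⨆ j, |(relative t j).im|

/-- The reduced function `F_N^r(lam; t, u)` for `N = n + 1`. -/
def reducedF {n : ℕ} (lam : ℂ) (t u : Fin (n + 1) → ℂ) : ℂ :=
  1 / (n.factorial : ℂ) * ∫ s : Fin n → ℝ, stepIntegrand (F n lam) lam (relative t) u 0 s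

/-- The set `A_N^r`. -/
def reducedDomain (N : ℕ) : Set (Fin N → ℂ) := {t | maxIm t < Real.pi / 2}

/-- The domain `D_N` of triples `(lam, t, u)`. -/
def holoDomain (N : ℕ) : Set (ℂ × (Fin N → ℂ) × (Fin N → ℂ)) :=
  {p | 1 < p.1.re ∧ p.2.1 ∈ reducedDomain N ∧
    ∀ j k, |(p.2.2 j - p.2.2 k).im| < 2 * p.1.re}

/-- The set `D_N` with its boundary part `Re lam = 1` added. -/
def extDomain (N : ℕ) : Set (ℂ × (Fin N → ℂ) × (Fin N → ℂ)) :=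
  {p | 1 ≤ p.1.re ∧ p.2.1 ∈ reducedDomain N ∧
    ∀ j k, |(p.2.2 j - p.2.2 k).im| < 2 * p.1.re}

/-- The alternating sum `∑_τ (-)^τ exp(-∑_j Re(t^{(N)}_{τ(j)}) Im(u^{(N)}_j))`. -/
def altSum {N : ℕ} (t u : Fin N → ℂ) : ℝ :=
  ∑ τ : Equiv.Perm (Fin N), ((Equiv.Perm.sign τ : ℤ) : ℝ) *
    Real.exp (-∑ j, (relative t (τ j)).re * (relative u j).im)

/-- The product `∏_{j<k} sin(π Im(u_k - u_j) / (2 Re lam)) sinh(Re lam Re(t_j - t_k))`. -/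
def boundDenom {N : ℕ} (lam : ℂ) (t u : Fin N → ℂ) : ℝ :=
  ∏ j, ∏ k ∈ Finset.Ioi j,
    (Real.sin (Real.pi * (u k - u j).im / (2 * lam.re)) *
      Real.sinh (lam.re * (t j - t k).re))

end CalogeroMoser

end

noncomputable section

namespace CalogeroMoser

open MeasureTheory Filter Topology
open scoped ENNReal

/-! Everything rests on one positive function, `majorant`: the recursion for F without factorials,
at real coupling l, real variables and purely imaginary spectral parameters. Taking absolute values
in the recursion gives |F_n(λ; x, u)| ≤ `majorant n (Re λ) x (Im u)` for real x. Since `majorant`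
takes values in [0, ∞], estimates can be made before any convergence is known.

At l = 1 the majorant is explicit. The ratio of hyperbolic products `cauchyKernel` is a Cauchy
determinant, a bordered determinant of tanh entries, so the recursion integral splits into
one-variable Laplace transforms. By induction (`exists_majorant_one_eq`) the majorant is a positive
constant times ∏ `tanhLaplace` times det exp(-y_i w_j) divided by `sinhProd y`. Each `tanhLaplace`
is at most 2π divided by a sine in absolute value, so this is the quotient appearing in the bound.

A coupling l ≥ 1 reduces to l = 1 by scaling x to l x and v to v/l
(`exists_majorant_le_majorant_one`). This proves (c) and finiteness at generic points. Local
domination at all points needs two more facts: up to exponential factors, |sinhProd x|^l times the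
majorant decreases in l (`exists_majorant_mono`), and the majorant is convex in v, so coinciding
spectral parameters are controlled by nearby distinct ones (`majorant_sum_smul_le`).

With an integrable local bound, continuity and holomorphy pass through the integral, by induction on
the number of variables (`regular`). The recursion uses a contour whose height depends on t;
`Regular.shiftedIntegral_eq` moves it. The normalized integral is holomorphic in the shift and
invariant under real shifts, hence constant. -/

/-! ### Cauchy's determinant in hyperbolic form. -/

/-- The product of `f j k` over the pairs `j < k`, split by whether `k` is the last index. -/
theorem prod_Ioi_castSucc {M : Type*} [CommMonoid M] {n : ℕ} (f : Fin (n + 1) → Fin (n + 1) → M) :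
    ∏ j, ∏ k ∈ Finset.Ioi j, f j k =
      (∏ j : Fin n, ∏ k ∈ Finset.Ioi j, f j.castSucc k.castSucc) *
        ∏ j : Fin n, f j.castSucc (Fin.last n) := by
  have h : ∀ {m : ℕ} (g : Fin m → Fin m → M),
      ∏ j, ∏ k ∈ Finset.Ioi j, g j k = ∏ j, ∏ k, if j < k then g j k else 1 := by
    intro m g
    refine Finset.prod_congr rfl fun j _ => ?_
    rw [← Finset.prod_filter]
    congr 1
    ext k
    simp
  rw [h, h, Fin.prod_univ_castSucc]
  simp only [Fin.prod_univ_castSucc (n := n), Fin.castSucc_lt_castSucc_iff, Fin.castSucc_lt_last,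
    if_true, Finset.prod_mul_distrib]
  have : ∀ k : Fin n, ¬ Fin.last n < k.castSucc := fun k => not_lt.2 (Fin.le_last _)
  simp [this]

/-- The matrix with `n` columns `g j k` followed by a column of ones. -/
def bordered {n : ℕ} (g : Fin (n + 1) → Fin n → ℝ) : Matrix (Fin (n + 1)) (Fin (n + 1)) ℝ :=
  Matrix.of fun j => Fin.snoc (α := fun _ => ℝ) (g j) 1

@[simp] theorem bordered_castSucc {n : ℕ} (g : Fin (n + 1) → Fin n → ℝ) (j : Fin (n + 1))
    (k : Fin n) : bordered g j k.castSucc = g j k := by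
  simp [bordered]

@[simp] theorem bordered_last {n : ℕ} (g : Fin (n + 1) → Fin n → ℝ) (j : Fin (n + 1)) :
    bordered g j (Fin.last n) = 1 := by
  simp [bordered]

theorem det_bordered {n : ℕ} (g : Fin (n + 1) → Fin n → ℝ) :
    (bordered g).det =
      ∑ σ : Equiv.Perm (Fin (n + 1)), ((Equiv.Perm.sign σ : ℤ) : ℝ) *
        ∏ k : Fin n, g (σ k.castSucc) k := by
  rw [Matrix.det_apply']
  refine Finset.sum_congr rfl fun σ _ => ?_
  rw [Fin.prod_univ_castSucc]
  simp

/-- Column operations on a bordered matrix. -/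
theorem det_bordered_affine {n : ℕ} (g : Fin (n + 1) → Fin n → ℝ) (a b : Fin n → ℝ) :
    (bordered fun j k => a k * g j k + b k).det = (∏ k, a k) * (bordered g).det := by
  have h1 : (bordered fun j k => a k * g j k + b k).det = (bordered fun j k => a k * g j k).det := by
    rw [← Matrix.det_transpose, ← Matrix.det_transpose (bordered fun j k => a k * g j k)]
    refine Matrix.det_eq_of_forall_row_eq_smul_add_const
      (Fin.snoc (α := fun _ => ℝ) b 0) (Fin.last n) (by simp) fun i j => ?_
    refine Fin.lastCases ?_ (fun k => ?_) i <;> simp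
  rw [h1]
  have h2 : (bordered fun j k => a k * g j k) =
      Matrix.of fun i j => (Fin.snoc (α := fun _ => ℝ) a 1 : Fin (n + 1) → ℝ) j * bordered g i j := by
    ext i j
    refine Fin.lastCases ?_ (fun k => ?_) j <;> simp
  rw [h2, Matrix.det_mul_row, Fin.prod_univ_castSucc]
  simp

/-- Expansion of a bordered determinant after subtracting the last row. -/
theorem det_bordered_eq_det_sub {n : ℕ} (g : Fin (n + 1) → Fin n → ℝ) :
    (bordered g).det =
      (Matrix.of fun j k : Fin n => g j.castSucc k - g (Fin.last n) k).det := by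
  have h1 : (bordered g).det = (Matrix.of fun i j =>
      (Fin.lastCases (motive := fun _ => ℝ) (bordered g (Fin.last n) j)
        (fun i' => bordered g i'.castSucc j - bordered g (Fin.last n) j) i)).det := by
    refine Matrix.det_eq_of_forall_row_eq_smul_add_const
      (Fin.snoc (α := fun _ => ℝ) (fun _ => 1) 0) (Fin.last n) (by simp) fun i j => ?_
    refine Fin.lastCases ?_ (fun i' => ?_) i <;> simp
  rw [h1, Matrix.det_succ_column _ (Fin.last n), Fin.sum_univ_castSucc]
  simp only [Matrix.of_apply, Fin.lastCases_castSucc, bordered_last, sub_self, mul_zero, zero_mul,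
    Finset.sum_const_zero, zero_add, Fin.lastCases_last, mul_one]
  rw [show (-1 : ℝ) ^ ((Fin.last n : ℕ) + (Fin.last n : ℕ)) = 1 from
    Even.neg_one_pow ⟨_, rfl⟩, one_mul]
  congr 1
  ext i j
  simp [Matrix.submatrix]

/-- A hyperbolic form of Cauchy's determinant with `n + 1` rows and `n` columns. -/
theorem det_bordered_tanh {n : ℕ} (y : Fin (n + 1) → ℝ) (s : Fin n → ℝ) :
    (bordered fun j k => Real.tanh (y j - s k)).det =
      (∏ j, ∏ k ∈ Finset.Ioi j, Real.sinh (y j - y k)) *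
        (∏ j, ∏ k ∈ Finset.Ioi j, Real.sinh (s j - s k)) /
          ∏ j, ∏ k, Real.cosh (y j - s k) := by
  induction n with
  | zero =>
    rw [det_bordered]
    simp [Finset.prod_eq_one]
  | succ n ih =>
    have hc : ∀ z : ℝ, Real.cosh z ≠ 0 := fun z => (Real.cosh_pos z).ne'
    set y' : Fin (n + 1) → ℝ := fun j => y j.castSucc
    set s' : Fin n → ℝ := fun j => s j.castSucc
    set b := y (Fin.last _)
    set c := s (Fin.last n)
    rw [det_bordered_eq_det_sub]
    -- By tanh p - tanh q = sinh(p - q)/(cosh p cosh q), row and column factors split off. What is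
    -- left is cosh(y'_j - c)/cosh(y'_j - s'_k), which is affine in tanh(y'_j - s'_k) with
    -- coefficients depending on k only, and its last column (s_k = c) is 1. It is thus a bordered
    -- tanh matrix up to column operations.
    have e1 : (Matrix.of fun j k : Fin (n + 1) =>
          Real.tanh (y j.castSucc - s k) - Real.tanh (y (Fin.last (n + 1)) - s k)) =
        Matrix.of fun j k => (Real.cosh (b - s k))⁻¹ * (Matrix.of fun j k =>
          (Real.sinh (y' j - b) / Real.cosh (y' j - c)) *
            (bordered fun j k => Real.sinh (s' k - c) * Real.tanh (y' j - s' k)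
              + Real.cosh (s' k - c)) j k) j k := by
      ext j k
      refine Fin.lastCases ?_ (fun k => ?_) k
      · simp only [Matrix.of_apply, bordered_last, Real.tanh_eq_sinh_div_cosh]
        change Real.sinh (y' j - c) / Real.cosh (y' j - c) -
          Real.sinh (b - c) / Real.cosh (b - c) = (Real.cosh (b - c))⁻¹ * _
        have key : Real.sinh (y' j - b) = Real.sinh (y' j - c) * Real.cosh (b - c)
            - Real.cosh (y' j - c) * Real.sinh (b - c) := by
          rw [← Real.sinh_sub]; congr 1; ring
        rw [key]
        have h1 := hc (y' j - c); have h2 := hc (b - c)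
        field_simp
      · simp only [Matrix.of_apply, bordered_castSucc, Real.tanh_eq_sinh_div_cosh]
        change Real.sinh (y' j - s' k) / Real.cosh (y' j - s' k) -
          Real.sinh (b - s' k) / Real.cosh (b - s' k) = (Real.cosh (b - s' k))⁻¹ * _
        have key : Real.sinh (y' j - b) = Real.sinh (y' j - s' k) * Real.cosh (b - s' k)
            - Real.cosh (y' j - s' k) * Real.sinh (b - s' k) := by
          rw [← Real.sinh_sub]; congr 1; ring
        have key2 : Real.cosh (y' j - c) = Real.cosh (y' j - s' k) * Real.cosh (s' k - c)
            + Real.sinh (y' j - s' k) * Real.sinh (s' k - c) := by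
          rw [← Real.cosh_add]; congr 1; ring
        have h1 := hc (y' j - c); have h2 := hc (b - s' k); have h3 := hc (y' j - s' k)
        have e : Real.sinh (s' k - c) * (Real.sinh (y' j - s' k) / Real.cosh (y' j - s' k)) +
            Real.cosh (s' k - c) = Real.cosh (y' j - c) / Real.cosh (y' j - s' k) := by
          rw [key2]; field_simp; ring
        rw [e, key]
        field_simp
    rw [e1, Matrix.det_mul_row, Matrix.det_mul_column, det_bordered_affine, ih y' s']
    rw [prod_Ioi_castSucc (fun j k => Real.sinh (y j - y k)),
      prod_Ioi_castSucc (fun j k => Real.sinh (s j - s k)),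
      Fin.prod_univ_castSucc (fun j => ∏ k, Real.cosh (y j - s k))]
    simp_rw [Fin.prod_univ_castSucc (fun k => Real.cosh (y _ - s k))]
    rw [Finset.prod_inv_distrib, Finset.prod_div_distrib, Finset.prod_mul_distrib,
      Fin.prod_univ_castSucc (fun k => Real.cosh (b - s k))]
    simp only [y', s', b, c]
    have hp : ∀ (t : Finset (Fin n)) (f : Fin n → ℝ), ∏ k ∈ t, Real.cosh (f k) ≠ 0 :=
      fun t f => Finset.prod_ne_zero_iff.2 fun _ _ => hc _
    have hp' : ∀ (t : Finset (Fin (n + 1))) (f : Fin (n + 1) → ℝ), ∏ k ∈ t, Real.cosh (f k) ≠ 0 :=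
      fun t f => Finset.prod_ne_zero_iff.2 fun _ _ => hc _
    have hpp : ∏ j : Fin (n + 1), ∏ k : Fin n, Real.cosh (y j.castSucc - s k.castSucc) ≠ 0 :=
      Finset.prod_ne_zero_iff.2 fun _ _ => hp _ _
    field_simp

/-! ### The one-variable integral. -/

/-- The Laplace transform of `r ↦ tanh (-r) - sign w`. -/
def tanhLaplace (w : ℝ) : ℝ :=
  ∫ r : ℝ, (Real.tanh (-r) - Real.sign w) * Real.exp (-(r * w))

theorem integrable_exp_neg_mul_abs {δ : ℝ} (hδ : 0 < δ) :
    Integrable fun r : ℝ => Real.exp (-(δ * |r|)) := by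
  rw [← integrableOn_univ, ← Set.Iic_union_Ioi (a := (0 : ℝ))]
  refine IntegrableOn.union ?_ ?_
  · refine (integrableOn_exp_mul_Iic hδ 0).congr_fun (fun r hr => ?_) measurableSet_Iic
    simp [abs_of_nonpos (show r ≤ 0 from hr)]
  · refine (integrableOn_exp_mul_Ioi (neg_lt_zero.2 hδ) 0).congr_fun (fun r hr => ?_)
      measurableSet_Ioi
    simp [abs_of_pos (show 0 < r from hr)]

theorem integral_exp_neg_mul_abs {δ : ℝ} (hδ : 0 < δ) :
    ∫ r : ℝ, Real.exp (-(δ * |r|)) = 2 / δ := by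
  rw [integral_comp_abs (f := fun r => Real.exp (-(δ * r)))]
  have := integral_exp_mul_Ioi (neg_lt_zero.2 hδ) 0
  simp only [neg_mul] at this
  rw [this]
  simp
  ring

theorem exp_abs_le_two_mul_cosh (r : ℝ) : Real.exp |r| ≤ 2 * Real.cosh r := by
  rw [← Real.cosh_abs, Real.cosh_eq]
  have := Real.exp_pos (-|r|)
  linarith

/-- The constant sign w cancels the limit of tanh on the side where exp(-r w) grows. Both signs of w
reduce to one positive integrand, which decays for 0 < |w| < 2. -/
theorem tanh_sub_sign_mul_exp {w : ℝ} (hw : w ≠ 0) (r : ℝ) :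
    (Real.tanh (-r) - Real.sign w) * Real.exp (-(r * w)) =
      -Real.sign w * (Real.exp (r * Real.sign w * (1 - |w|)) / Real.cosh r) := by
  have hc := (Real.cosh_pos r).ne'
  rw [Real.tanh_neg, Real.tanh_eq_sinh_div_cosh]
  rcases hw.lt_or_gt with h | h
  · rw [Real.sign_of_neg h, abs_of_neg h]
    have : -(Real.sinh r / Real.cosh r) - -1 = Real.exp (-r) / Real.cosh r := by
      rw [← Real.cosh_sub_sinh]; field_simp; ring
    rw [this, div_mul_eq_mul_div, ← Real.exp_add]
    ring_nf
  · rw [Real.sign_of_pos h, abs_of_pos h]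
    have : -(Real.sinh r / Real.cosh r) - 1 = -(Real.exp r / Real.cosh r) := by
      rw [← Real.cosh_add_sinh]; field_simp; ring
    rw [this, neg_mul, div_mul_eq_mul_div, ← Real.exp_add]
    ring_nf

theorem exp_div_cosh_le {a w : ℝ} (ha : |a| = 1) (r : ℝ) :
    Real.exp (r * a * (1 - |w|)) / Real.cosh r ≤
      2 * Real.exp (-((1 - abs (1 - |w|)) * |r|)) := by
  rw [div_le_iff₀ (Real.cosh_pos r)]
  have h1 : Real.exp (r * a * (1 - |w|)) ≤ Real.exp (-((1 - abs (1 - |w|)) * |r|)) * Real.exp |r| := by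
    rw [← Real.exp_add, Real.exp_le_exp]
    calc r * a * (1 - |w|) ≤ |r * a * (1 - |w|)| := le_abs_self _
      _ = |r| * abs (1 - |w|) := by rw [abs_mul, abs_mul, ha, mul_one]
      _ = _ := by ring
  have h2 := exp_abs_le_two_mul_cosh r
  nlinarith [Real.exp_pos (-((1 - abs (1 - |w|)) * |r|))]

theorem abs_sign_eq_one {w : ℝ} (hw : w ≠ 0) : |Real.sign w| = 1 := by
  rcases hw.lt_or_gt with h | h
  · simp [Real.sign_of_neg h]
  · simp [Real.sign_of_pos h]

theorem integrable_tanh_sub_sign_aux {w : ℝ} (hw : w ≠ 0) (hw2 : |w| < 2) :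
    Integrable fun r : ℝ => Real.exp (r * Real.sign w * (1 - |w|)) / Real.cosh r := by
  have hδ : 0 < 1 - abs (1 - |w|) := by
    have := abs_pos.2 hw
    rw [sub_pos, abs_lt]; constructor <;> linarith
  refine ((integrable_exp_neg_mul_abs hδ).const_mul 2).mono' ?_ (.of_forall fun r => ?_)
  · refine Continuous.aestronglyMeasurable ?_
    exact Continuous.div (by fun_prop) Real.continuous_cosh fun r => (Real.cosh_pos r).ne'
  · rw [Real.norm_of_nonneg (div_nonneg (Real.exp_pos _).le (Real.cosh_pos r).le)]
    exact exp_div_cosh_le (abs_sign_eq_one hw) r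

theorem integrable_tanh_sub_sign {w : ℝ} (hw : w ≠ 0) (hw2 : |w| < 2) (y : ℝ) :
    Integrable fun s : ℝ => (Real.tanh (y - s) - Real.sign w) * Real.exp (-(s * w)) := by
  have h : Integrable fun r : ℝ => (Real.tanh (-r) - Real.sign w) * Real.exp (-(r * w)) := by
    simp_rw [tanh_sub_sign_mul_exp hw]
    exact (integrable_tanh_sub_sign_aux hw hw2).const_mul _
  refine ((h.comp_sub_right y).mul_const (Real.exp (-(y * w)))).congr (.of_forall fun s => ?_)
  simp only
  rw [mul_assoc, ← Real.exp_add]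
  ring_nf

theorem integral_tanh_sub_sign (w y : ℝ) :
    ∫ s : ℝ, (Real.tanh (y - s) - Real.sign w) * Real.exp (-(s * w)) =
      Real.exp (-(y * w)) * tanhLaplace w := by
  rw [tanhLaplace, ← integral_const_mul, ← integral_sub_right_eq_self
    (fun r => Real.exp (-(y * w)) * ((Real.tanh (-r) - Real.sign w) * Real.exp (-(r * w)))) y]
  refine integral_congr_ae (.of_forall fun s => ?_)
  simp only
  rw [mul_left_comm, ← Real.exp_add]
  ring_nf

/-- `tanhLaplace` is comparable to the reciprocal of a sine. -/
theorem tanhLaplace_mul_sin_mem {w : ℝ} (hw : w ≠ 0) (hw2 : |w| < 2) :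
    tanhLaplace w * Real.sin (-(Real.pi * w / 2)) ∈ Set.Icc 0 (2 * Real.pi) := by
  set I := ∫ r : ℝ, Real.exp (r * Real.sign w * (1 - |w|)) / Real.cosh r with hI
  have hwpos := abs_pos.2 hw
  have hδ : 0 < 1 - abs (1 - |w|) := by
    rw [sub_pos, abs_lt]; constructor <;> linarith
  have e1 : tanhLaplace w = -Real.sign w * I := by
    rw [tanhLaplace, hI, ← integral_const_mul]
    simp_rw [tanh_sub_sign_mul_exp hw]
  have e2 : tanhLaplace w * Real.sin (-(Real.pi * w / 2)) = I * Real.sin (Real.pi * |w| / 2) := by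
    rw [e1]
    rcases hw.lt_or_gt with h | h
    · rw [Real.sign_of_neg h, abs_of_neg h]
      rw [show -(Real.pi * w / 2) = Real.pi * -w / 2 by ring]; ring
    · rw [Real.sign_of_pos h, abs_of_pos h, Real.sin_neg]; ring
  -- The integral blows up at most like 1/δ with δ = 1 - |1 - |w||, and the sine is at most a
  -- multiple of δ, as it vanishes at |w| = 0 and |w| = 2. This crude bound replaces the exact
  -- evaluation of the integral.
  have hI0 : 0 ≤ I := integral_nonneg fun r =>
    div_nonneg (Real.exp_pos _).le (Real.cosh_pos r).le
  have hI1 : I ≤ 4 / (1 - abs (1 - |w|)) := by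
    calc I ≤ ∫ r : ℝ, 2 * Real.exp (-((1 - abs (1 - |w|)) * |r|)) :=
          integral_mono (integrable_tanh_sub_sign_aux hw hw2)
            ((integrable_exp_neg_mul_abs hδ).const_mul 2) (exp_div_cosh_le (abs_sign_eq_one hw))
      _ = _ := by rw [integral_const_mul, integral_exp_neg_mul_abs hδ]; ring
  have hpi := Real.pi_pos
  have hs0 : 0 ≤ Real.sin (Real.pi * |w| / 2) :=
    Real.sin_nonneg_of_nonneg_of_le_pi (by positivity) (by nlinarith)
  have hs1 : Real.sin (Real.pi * |w| / 2) ≤ Real.pi / 2 * (1 - abs (1 - |w|)) := by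
    rcases le_total |w| 1 with h | h
    · rw [abs_of_nonneg (sub_nonneg.2 h)]
      have := Real.sin_le (x := Real.pi * |w| / 2) (by positivity)
      linarith
    · rw [abs_of_nonpos (sub_nonpos.2 h), ← Real.sin_pi_sub]
      have := Real.sin_le (x := Real.pi - Real.pi * |w| / 2) (by nlinarith)
      linarith
  rw [e2]
  refine ⟨mul_nonneg hI0 hs0, ?_⟩
  calc I * Real.sin (Real.pi * |w| / 2)
      ≤ 4 / (1 - abs (1 - |w|)) * (Real.pi / 2 * (1 - abs (1 - |w|))) :=
        mul_le_mul hI1 hs1 hs0 (by positivity)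
    _ = 2 * Real.pi := by field_simp; ring

/-! ### The majorant and its closed form at coupling one. -/

/-- The product `∏_{j<k} 2 sinh (s_j - s_k)` for real `s`. -/
def sinhProd {n : ℕ} (s : Fin n → ℝ) : ℝ :=
  ∏ j, ∏ k ∈ Finset.Ioi j, 2 * Real.sinh (s j - s k)

/-- The product `∏_j ∏_k 2 cosh (x_j - s_k)` for real arguments. -/
def coshProd {n : ℕ} (x : Fin (n + 1) → ℝ) (s : Fin n → ℝ) : ℝ :=
  ∏ j, ∏ k, 2 * Real.cosh (x j - s k)

/-- The differences `v_j - v_{n+1}` for `j ≤ n`. -/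
def dropLast {R : Type*} [Sub R] {n : ℕ} (v : Fin (n + 1) → R) : Fin n → R :=
  fun j => v j.castSucc - v (Fin.last n)

/-- The extended nonnegative real defined by the recursion for `F` (without factorials) at a real
coupling `l`, real variables `x` and purely imaginary spectral parameters `I * v`. -/
def majorant : (n : ℕ) → ℝ → (Fin n → ℝ) → (Fin n → ℝ) → ℝ≥0∞
  | 0, _, _, _ => 1
  | n + 1, l, x, v =>
      ENNReal.ofReal (Real.exp (-(v (Fin.last n) * ∑ j, x j))) *
        ∫⁻ s : Fin n → ℝ, ENNReal.ofReal (|sinhProd s| ^ (2 * l) / coshProd x s ^ l) *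
          majorant n l s (dropLast v)

theorem coshProd_pos {n : ℕ} (x : Fin (n + 1) → ℝ) (s : Fin n → ℝ) : 0 < coshProd x s :=
  Finset.prod_pos fun _ _ => Finset.prod_pos fun _ _ => mul_pos two_pos (Real.cosh_pos _)

theorem sinhProd_ne_zero {n : ℕ} {s : Fin n → ℝ} (hs : Function.Injective s) : sinhProd s ≠ 0 := by
  refine Finset.prod_ne_zero_iff.2 fun j _ => Finset.prod_ne_zero_iff.2 fun k hk => ?_
  have : s j ≠ s k := hs.ne (Finset.mem_Ioi.1 hk).ne
  simpa [Real.sinh_eq_zero, sub_eq_zero] using this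

theorem sinhProd_comp_perm {n : ℕ} (s : Fin n → ℝ) (τ : Equiv.Perm (Fin n)) :
    sinhProd (s ∘ τ) = ((Equiv.Perm.sign τ : ℤ) : ℝ) * sinhProd s :=
  τ.prod_Ioi_comp_eq_sign_mul_prod (f := fun j k => 2 * Real.sinh (s j - s k)) fun i j => by
    rw [← neg_sub (s j), Real.sinh_neg]; ring

theorem coshProd_comp_perm {n : ℕ} (x : Fin (n + 1) → ℝ) (s : Fin n → ℝ)
    (τ : Equiv.Perm (Fin n)) : coshProd x (s ∘ τ) = coshProd x s :=
  Finset.prod_congr rfl fun j _ => Equiv.prod_comp τ fun k => 2 * Real.cosh (x j - s k)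

@[fun_prop]
theorem continuous_sinhProd {n : ℕ} : Continuous (sinhProd (n := n)) := by
  unfold sinhProd; fun_prop

@[fun_prop]
theorem Continuous.coshProd {α : Type*} [TopologicalSpace α] {n : ℕ} {f : α → Fin (n + 1) → ℝ}
    {g : α → Fin n → ℝ} (hf : Continuous f) (hg : Continuous g) :
    Continuous fun a => coshProd (f a) (g a) := by
  unfold CalogeroMoser.coshProd; fun_prop

/-- Cauchy's determinant in terms of `sinhProd` and `coshProd`. -/
theorem exists_sinhProd_mul_div_coshProd_eq (n : ℕ) :
    ∃ c : ℝ, 0 < c ∧ ∀ (y : Fin (n + 1) → ℝ) (s : Fin n → ℝ) (a : Fin n → ℝ),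
      sinhProd y * sinhProd s / coshProd y s =
        c * (bordered fun j k => Real.tanh (y j - s k) - a k).det := by
  have h : ∀ m : ℕ, ∃ p : ℝ, 0 < p ∧ ∀ s : Fin m → ℝ,
      sinhProd s = p * ∏ j, ∏ k ∈ Finset.Ioi j, Real.sinh (s j - s k) := fun m =>
    ⟨∏ j : Fin m, ∏ k ∈ Finset.Ioi j, 2, by positivity, fun s => by
      simp only [sinhProd, Finset.prod_mul_distrib]⟩
  obtain ⟨p, hp, hp'⟩ := h (n + 1)
  obtain ⟨q, hq, hq'⟩ := h n
  refine ⟨p * q / ∏ j : Fin (n + 1), ∏ k : Fin n, 2, by positivity, fun y s a => ?_⟩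
  -- Thanks to the column of ones, any constant a_k may be subtracted from column k. It will be sign
  -- w_k, to make the integrals converge.
  have h1 := det_bordered_affine (fun j k => Real.tanh (y j - s k)) (fun _ => 1) fun k => -a k
  simp only [one_mul, Finset.prod_const_one, ← sub_eq_add_neg] at h1
  rw [h1, det_bordered_tanh, hp', hq']
  simp only [coshProd, Finset.prod_mul_distrib]
  ring

theorem ae_injective (n : ℕ) : ∀ᵐ s : Fin n → ℝ, Function.Injective s := by
  have h : ∀ j k : Fin n, j ≠ k → ∀ᵐ s : Fin n → ℝ, s j ≠ s k := by
    intro j k hjk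
    let p : Submodule ℝ (Fin n → ℝ) :=
      LinearMap.ker (LinearMap.proj (R := ℝ) (φ := fun _ : Fin n => ℝ) j - LinearMap.proj k)
    have hp : p ≠ ⊤ := by
      intro h
      have : (Pi.single j 1 : Fin n → ℝ) ∈ p := h ▸ Submodule.mem_top
      simp [p, hjk.symm] at this
    have := Measure.addHaar_submodule (volume : Measure (Fin n → ℝ)) p hp
    filter_upwards [measure_eq_zero_iff_ae_notMem.1 this] with s hs h
    exact hs (by simp [p, h])
  have h2 : ∀ᵐ s : Fin n → ℝ, ∀ j k, j ≠ k → s j ≠ s k := by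
    simp_rw [ae_all_iff]
    exact h
  filter_upwards [h2] with s hs j k hjk
  by_contra hne
  exact hs j k hne hjk

theorem measurePreserving_comp_perm {n : ℕ} (τ : Equiv.Perm (Fin n)) :
    MeasurePreserving fun s : Fin n → ℝ => s ∘ τ := by
  convert! volume_measurePreserving_piCongrLeft (fun _ : Fin n => ℝ) τ.symm using 1
  ext s i
  have := Equiv.piCongrLeft_apply_apply (fun _ : Fin n => ℝ) τ.symm s (τ i)
  rw [MeasurableEquiv.coe_piCongrLeft]
  simpa using this.symm

theorem integral_comp_perm {n : ℕ} (τ : Equiv.Perm (Fin n)) {f : (Fin n → ℝ) → ℝ}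
    (hf : Integrable f) : ∫ s, f (s ∘ τ) = ∫ s, f s := by
  have h := measurePreserving_comp_perm τ
  rw [← h.map_eq] at hf
  rw [← integral_map h.aemeasurable hf.aestronglyMeasurable, h.map_eq]

/-- The kernel obtained from Cauchy's determinant. -/
def cauchyKernel {n : ℕ} (y : Fin (n + 1) → ℝ) (s : Fin n → ℝ) : ℝ :=
  sinhProd y * sinhProd s / coshProd y s

theorem cauchyKernel_comp_perm {n : ℕ} (y : Fin (n + 1) → ℝ) (s : Fin n → ℝ)
    (τ : Equiv.Perm (Fin n)) :
    cauchyKernel y (s ∘ τ) = ((Equiv.Perm.sign τ : ℤ) : ℝ) * cauchyKernel y s := by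
  rw [cauchyKernel, cauchyKernel, sinhProd_comp_perm, coshProd_comp_perm]
  ring

/-- Each term of the expanded bordered determinant is a product of functions of one variable s_k, so
the integral factorizes. -/
theorem exists_integral_cauchyKernel_mul_exp (n : ℕ) :
    ∃ c : ℝ, 0 < c ∧ ∀ (y : Fin (n + 1) → ℝ) (w : Fin n → ℝ), (∀ k, w k ≠ 0) → (∀ k, |w k| < 2) →
      Integrable (fun s => cauchyKernel y s * ∏ k, Real.exp (-(s k * w k))) ∧
      ∫ s, cauchyKernel y s * ∏ k, Real.exp (-(s k * w k)) =
        c * (∏ k, tanhLaplace (w k)) *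
          ∑ σ : Equiv.Perm (Fin (n + 1)), ((Equiv.Perm.sign σ : ℤ) : ℝ) *
            ∏ k : Fin n, Real.exp (-(y (σ k.castSucc) * w k)) := by
  obtain ⟨c, hc, h⟩ := exists_sinhProd_mul_div_coshProd_eq n
  refine ⟨c, hc, fun y w hw hw2 => ?_⟩
  have e : ∀ s : Fin n → ℝ, cauchyKernel y s * ∏ k, Real.exp (-(s k * w k)) =
      ∑ σ : Equiv.Perm (Fin (n + 1)), (c * ((Equiv.Perm.sign σ : ℤ) : ℝ)) *
        ∏ k : Fin n, (Real.tanh (y (σ k.castSucc) - s k) - Real.sign (w k)) *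
          Real.exp (-(s k * w k)) := by
    intro s
    rw [cauchyKernel, h y s fun k => Real.sign (w k), det_bordered, Finset.mul_sum, Finset.sum_mul]
    refine Finset.sum_congr rfl fun σ _ => ?_
    rw [Finset.prod_mul_distrib]
    ring
  have hi : ∀ σ : Equiv.Perm (Fin (n + 1)), Integrable fun s : Fin n → ℝ =>
      (c * ((Equiv.Perm.sign σ : ℤ) : ℝ)) *
        ∏ k : Fin n, (Real.tanh (y (σ k.castSucc) - s k) - Real.sign (w k)) *
          Real.exp (-(s k * w k)) := fun σ =>
    (Integrable.fintype_prod fun k => integrable_tanh_sub_sign (hw k) (hw2 k) _).const_mul _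
  simp_rw [e]
  refine ⟨integrable_finsetSum _ fun σ _ => hi σ, ?_⟩
  rw [integral_finsetSum _ fun σ _ => hi σ, Finset.mul_sum]
  refine Finset.sum_congr rfl fun σ _ => ?_
  rw [integral_const_mul, integral_fintype_prod_volume_eq_prod (fun k r =>
    (Real.tanh (y (σ k.castSucc) - r) - Real.sign (w k)) * Real.exp (-(r * w k)))]
  simp_rw [integral_tanh_sub_sign, Finset.prod_mul_distrib]
  ring

/-- The matrix with entries `exp (-(y_i w_j))`. -/
def expMatrix {n : ℕ} (y w : Fin n → ℝ) : Matrix (Fin n) (Fin n) ℝ :=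
  Matrix.of fun i j => Real.exp (-(y i * w j))

/-- The sum of the y_{σ(j)} does not depend on σ, so shifting all w_k by the last one only pulls out
a plane wave. That wave is the prefactor of the recursion, which therefore reproduces a determinant
of the same shape. -/
theorem det_expMatrix_succ {n : ℕ} (y w : Fin (n + 1) → ℝ) :
    (expMatrix y w).det = Real.exp (-(w (Fin.last n) * ∑ j, y j)) *
      ∑ σ : Equiv.Perm (Fin (n + 1)), ((Equiv.Perm.sign σ : ℤ) : ℝ) *
        ∏ k : Fin n, Real.exp (-(y (σ k.castSucc) * dropLast w k)) := by
  rw [Matrix.det_apply', Finset.mul_sum]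
  refine Finset.sum_congr rfl fun σ _ => ?_
  rw [mul_left_comm, ← Equiv.sum_comp σ y]
  congr 1
  simp only [expMatrix, Matrix.of_apply]
  rw [← Real.exp_sum, ← Real.exp_sum, ← Real.exp_add, Fin.sum_univ_castSucc, Fin.sum_univ_castSucc]
  congr 1
  simp only [dropLast, mul_sub, mul_add, neg_sub, Finset.sum_sub_distrib, Finset.sum_neg_distrib,
    Finset.mul_sum]
  simp only [mul_comm (w (Fin.last n))]
  ring

theorem cauchyKernel_mul_det {n : ℕ} (y : Fin (n + 1) → ℝ) (w s : Fin n → ℝ) :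
    cauchyKernel y s * (expMatrix s w).det =
      ∑ τ : Equiv.Perm (Fin n),
        cauchyKernel y (s ∘ τ) * ∏ k, Real.exp (-((s ∘ τ) k * w k)) := by
  rw [Matrix.det_apply', Finset.mul_sum]
  refine Finset.sum_congr rfl fun τ _ => ?_
  rw [cauchyKernel_comp_perm]
  simp only [expMatrix, Matrix.of_apply, Function.comp]
  ring

/-- The kernel is antisymmetric in s, so after relabelling the integration variables the n! terms of
the determinant contribute equally. -/
theorem exists_integral_cauchyKernel_mul_det (n : ℕ) :
    ∃ c : ℝ, 0 < c ∧ ∀ y w : Fin (n + 1) → ℝ, (∀ j k, j ≠ k → w j ≠ w k) →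
      (∀ j k, |w j - w k| < 2) →
      Integrable (fun s => cauchyKernel y s * (expMatrix s (dropLast w)).det) ∧
      Real.exp (-(w (Fin.last n) * ∑ j, y j)) *
        ∫ s, cauchyKernel y s * (expMatrix s (dropLast w)).det =
          c * (∏ k, tanhLaplace (dropLast w k)) * (expMatrix y w).det := by
  obtain ⟨c, hc, h⟩ := exists_integral_cauchyKernel_mul_exp n
  refine ⟨n.factorial * c, by positivity, fun y w hw hw2 => ?_⟩
  obtain ⟨hi, he⟩ := h y (dropLast w)
    (fun k => sub_ne_zero.2 (hw _ _ (Fin.castSucc_lt_last k).ne)) fun k => hw2 _ _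
  have hi' : ∀ τ : Equiv.Perm (Fin n), Integrable fun s : Fin n → ℝ =>
      cauchyKernel y (s ∘ τ) * ∏ k, Real.exp (-((s ∘ τ) k * dropLast w k)) := fun τ =>
    (measurePreserving_comp_perm τ).integrable_comp_of_integrable hi
  simp_rw [cauchyKernel_mul_det]
  refine ⟨integrable_finsetSum _ fun τ _ => hi' τ, ?_⟩
  rw [integral_finsetSum _ fun τ _ => hi' τ]
  have : ∀ τ : Equiv.Perm (Fin n), ∫ s : Fin n → ℝ,
      cauchyKernel y (s ∘ τ) * ∏ k, Real.exp (-((s ∘ τ) k * dropLast w k)) =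
      ∫ s : Fin n → ℝ, cauchyKernel y s * ∏ k, Real.exp (-(s k * dropLast w k)) := fun τ =>
    integral_comp_perm τ hi
  simp only [this, he, Finset.sum_const, Finset.card_univ, Fintype.card_perm, Fintype.card_fin,
    nsmul_eq_mul, det_expMatrix_succ]
  ring

/-- The closed form of the majorant at coupling one. -/
theorem exists_majorant_one_eq (n : ℕ) :
    ∃ c : ℝ, 0 < c ∧ ∀ y w : Fin n → ℝ, Function.Injective y → (∀ j k, j ≠ k → w j ≠ w k) →
      (∀ j k, |w j - w k| < 2) →
      0 < c * (∏ j, ∏ k ∈ Finset.Ioi j, tanhLaplace (w j - w k)) * (expMatrix y w).det /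
        sinhProd y ∧
      majorant n 1 y w = ENNReal.ofReal
        (c * (∏ j, ∏ k ∈ Finset.Ioi j, tanhLaplace (w j - w k)) * (expMatrix y w).det /
          sinhProd y) := by
  induction n with
  | zero => exact ⟨1, one_pos, fun y w _ _ _ => by simp [majorant, sinhProd]⟩
  | succ n ih =>
    obtain ⟨c, hc, ih⟩ := ih
    obtain ⟨d, hd, h⟩ := exists_integral_cauchyKernel_mul_det n
    refine ⟨c * d, by positivity, fun y w hy hw hw2 => ?_⟩
    obtain ⟨hi, he⟩ := h y w hw hw2
    have hsub : ∀ j k, dropLast w j - dropLast w k = w j.castSucc - w k.castSucc := fun j k => by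
      simp [dropLast]
    have ih' := fun s (hs : Function.Injective s) => ih s (dropLast w) hs
      (fun j k hjk h => hw j.castSucc k.castSucc (by simpa using hjk) (by
        simpa [sub_eq_zero, h] using (hsub j k).symm))
      (fun j k => by rw [hsub]; exact hw2 _ _)
    set A := ∏ j, ∏ k ∈ Finset.Ioi j, tanhLaplace (dropLast w j - dropLast w k) with hA
    have hy0 := sinhProd_ne_zero hy
    -- Of the squared `sinhProd s` in the weight, one factor cancels the denominator of the
    -- induction hypothesis. The other completes `cauchyKernel y s`, at the price of dividing by
    -- `sinhProd y`.
    set g : (Fin n → ℝ) → ℝ := fun s =>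
      (c * A / sinhProd y) * (cauchyKernel y s * (expMatrix s (dropLast w)).det) with hg
    have key : ∀ᵐ s : Fin n → ℝ, 0 < g s ∧
        ENNReal.ofReal (|sinhProd s| ^ (2 * (1 : ℝ)) / coshProd y s ^ (1 : ℝ)) *
          majorant n 1 s (dropLast w) = ENNReal.ofReal (g s) := by
      filter_upwards [ae_injective n] with s hs
      obtain ⟨hpos, heq⟩ := ih' s hs
      have hs0 := sinhProd_ne_zero hs
      have hcs := coshProd_pos y s
      have e : g s = |sinhProd s| ^ (2 * (1 : ℝ)) / coshProd y s ^ (1 : ℝ) *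
          (c * A * (expMatrix s (dropLast w)).det / sinhProd s) := by
        simp only [hg, cauchyKernel, mul_one, Real.rpow_one, Real.rpow_two, sq_abs]
        field_simp
      refine ⟨?_, ?_⟩
      · rw [e]
        refine mul_pos ?_ hpos
        have := abs_pos.2 hs0
        positivity
      · rw [heq, e, ENNReal.ofReal_mul (by positivity)]
    have hgi : Integrable g := hi.const_mul _
    -- The sign of the closed form is not apparent from the formula; it comes from the almost
    -- everywhere positive integrand.
    have hgpos : 0 < ∫ s, g s := by
      refine lt_of_le_of_ne (integral_nonneg_of_ae (key.mono fun s hs => hs.1.le)) fun h0 => ?_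
      have h1 := (integral_eq_zero_iff_of_nonneg_ae (key.mono fun s hs => hs.1.le) hgi).1 h0.symm
      obtain ⟨s, hs⟩ := (key.and h1).exists
      exact hs.1.1.ne' hs.2
    have e : c * d * (∏ j, ∏ k ∈ Finset.Ioi j, tanhLaplace (w j - w k)) * (expMatrix y w).det /
        sinhProd y = Real.exp (-(w (Fin.last n) * ∑ j, y j)) * ∫ s, g s := by
      rw [prod_Ioi_castSucc (fun j k => tanhLaplace (w j - w k)), hg, integral_const_mul,
        mul_left_comm (Real.exp _), he, hA]
      simp_rw [hsub]
      simp only [dropLast]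
      ring
    rw [e]
    refine ⟨by positivity, ?_⟩
    rw [majorant, lintegral_congr_ae (key.mono fun s hs => hs.2),
      ← ofReal_integral_eq_lintegral_ofReal hgi (key.mono fun s hs => hs.1.le),
      ENNReal.ofReal_mul (Real.exp_pos _).le]

/-! ### Dependence of the majorant on the coupling and on the spectral parameters. -/

theorem measurable_majorant {n : ℕ} (l : ℝ) (v : Fin n → ℝ) :
    Measurable fun x => majorant n l x v := by
  induction n with
  | zero => exact measurable_const
  | succ n ih =>
    simp only [majorant]
    refine Measurable.mul (by fun_prop) ?_
    refine Measurable.lintegral_prod_right' (f := fun p : (Fin (n + 1) → ℝ) × (Fin n → ℝ) =>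
      ENNReal.ofReal (|sinhProd p.2| ^ (2 * l) / coshProd p.1 p.2 ^ l) *
        majorant n l p.2 (dropLast v)) ?_
    refine Measurable.mul ?_ ((ih (dropLast v)).comp measurable_snd)
    have h1 : Measurable fun p : (Fin (n + 1) → ℝ) × (Fin n → ℝ) => sinhProd p.2 :=
      (continuous_sinhProd.comp continuous_snd).measurable
    have h2 : Measurable fun p : (Fin (n + 1) → ℝ) × (Fin n → ℝ) => coshProd p.1 p.2 :=
      (Continuous.coshProd continuous_fst continuous_snd).measurable
    exact (((h1.norm).pow_const _).div (h2.pow_const _)).ennreal_ofReal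

theorem measurable_stepDensity {n : ℕ} (l : ℝ) (x : Fin (n + 1) → ℝ) :
    Measurable fun s : Fin n → ℝ =>
      ENNReal.ofReal (|sinhProd s| ^ (2 * l) / coshProd x s ^ l) := by
  have h2 : Measurable fun s : Fin n → ℝ => coshProd x s :=
    (Continuous.coshProd continuous_const continuous_id).measurable
  exact ((continuous_sinhProd.measurable.norm.pow_const _).div (h2.pow_const _)).ennreal_ofReal

/-- For a ≥ 0 write 2 sinh a = e^a (1 - q) with q = e^{-2a}. The exponentials agree on both sides,
and (1 - q)^l ≤ 1 - q ≤ 1 - q^l. -/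
theorem abs_two_mul_sinh_rpow_le {l : ℝ} (hl : 1 ≤ l) (a : ℝ) :
    |2 * Real.sinh a| ^ l ≤ |2 * Real.sinh (l * a)| := by
  wlog ha : 0 ≤ a generalizing a
  · have := this (-a) (by linarith)
    rwa [mul_neg, Real.sinh_neg, Real.sinh_neg, mul_neg, mul_neg, abs_neg, abs_neg] at this
  have h : ∀ b : ℝ, 2 * Real.sinh b = Real.exp b * (1 - Real.exp (-2 * b)) := fun b => by
    rw [Real.sinh_eq, mul_sub, ← Real.exp_add]; ring_nf
  have h0 : 0 ≤ 1 - Real.exp (-2 * a) := by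
    rw [sub_nonneg, Real.exp_le_one_iff]; linarith
  rw [abs_of_nonneg (by have := Real.sinh_nonneg_iff.2 ha; linarith),
    abs_of_nonneg (by have := Real.sinh_nonneg_iff.2 (show 0 ≤ l * a by positivity); linarith),
    h, h, Real.mul_rpow (Real.exp_pos _).le h0, ← Real.exp_mul, mul_comm a l]
  refine mul_le_mul_of_nonneg_left ?_ (Real.exp_pos _).le
  calc (1 - Real.exp (-2 * a)) ^ l ≤ (1 - Real.exp (-2 * a)) ^ (1 : ℝ) :=
        Real.rpow_le_rpow_of_exponent_ge_of_imp h0 (by linarith [Real.exp_pos (-2 * a)]) hl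
          (fun _ h => absurd h (zero_lt_one.trans_le hl).ne')
    _ ≤ 1 - Real.exp (-2 * (l * a)) := by
        rw [Real.rpow_one]
        have : Real.exp (-2 * (l * a)) ≤ Real.exp (-2 * a) := by
          rw [Real.exp_le_exp]; nlinarith
        linarith

/-- Both sides compare with e^{l|a|}. The extra factor 2 only affects a constant depending on n. -/
theorem two_mul_cosh_mul_le {l : ℝ} (hl : 0 ≤ l) (a : ℝ) :
    2 * Real.cosh (l * a) ≤ 2 * (2 * Real.cosh a) ^ l := by
  have h1 : Real.cosh (l * a) ≤ Real.exp (l * |a|) := by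
    rw [← Real.cosh_abs, abs_mul, abs_of_nonneg hl, Real.cosh_eq]
    have : Real.exp (-(l * |a|)) ≤ Real.exp (l * |a|) := by
      rw [Real.exp_le_exp]; have : 0 ≤ l * |a| := by positivity
      linarith
    linarith
  have h2 : Real.exp (l * |a|) ≤ (2 * Real.cosh a) ^ l := by
    rw [mul_comm, Real.exp_mul]
    exact Real.rpow_le_rpow (Real.exp_pos _).le (exp_abs_le_two_mul_cosh a) hl
  linarith

theorem abs_sinhProd_rpow_le {n : ℕ} {l : ℝ} (hl : 1 ≤ l) (s : Fin n → ℝ) :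
    |sinhProd s| ^ l ≤ |sinhProd (l • s)| := by
  simp only [sinhProd, Finset.abs_prod]
  rw [← Real.finsetProd_rpow _ _ fun _ _ => Finset.prod_nonneg fun _ _ => abs_nonneg _]
  refine Finset.prod_le_prod (fun _ _ => by positivity) fun j _ => ?_
  rw [← Real.finsetProd_rpow _ _ fun _ _ => abs_nonneg _]
  refine Finset.prod_le_prod (fun _ _ => by positivity) fun k _ => ?_
  simpa [mul_sub] using abs_two_mul_sinh_rpow_le hl (s j - s k)

theorem coshProd_smul_le {n : ℕ} {l : ℝ} (hl : 0 ≤ l) (x : Fin (n + 1) → ℝ) (s : Fin n → ℝ) :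
    coshProd (l • x) (l • s) ≤ (2 : ℝ) ^ (n * (n + 1)) * coshProd x s ^ l := by
  have hc : ∀ j k, 0 ≤ 2 * Real.cosh (x j - s k) := fun j k =>
    (mul_pos two_pos (Real.cosh_pos _)).le
  have e : (2 : ℝ) ^ (n * (n + 1)) * coshProd x s ^ l =
      ∏ j, ∏ k, 2 * (2 * Real.cosh (x j - s k)) ^ l := by
    have h2 : ∏ _j : Fin (n + 1), ∏ _k : Fin n, (2 : ℝ) = 2 ^ (n * (n + 1)) := by simp [pow_mul]
    simp_rw [Finset.prod_mul_distrib]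
    rw [h2, coshProd, ← Real.finsetProd_rpow _ _ fun _ _ => Finset.prod_nonneg fun _ _ => hc _ _]
    congr 1
    refine Finset.prod_congr rfl fun j _ => ?_
    rw [← Real.finsetProd_rpow _ _ fun _ _ => hc _ _]
  rw [e]
  refine Finset.prod_le_prod (fun _ _ => Finset.prod_nonneg fun _ _ =>
    (mul_pos two_pos (Real.cosh_pos _)).le) fun j _ => Finset.prod_le_prod (fun _ _ =>
    (mul_pos two_pos (Real.cosh_pos _)).le) fun k _ => ?_
  simpa [mul_sub] using two_mul_cosh_mul_le hl (x j - s k)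

theorem lintegral_comp_smul_le {n : ℕ} {l : ℝ} (hl : 1 ≤ l) {f : (Fin n → ℝ) → ℝ≥0∞}
    (hf : Measurable f) : ∫⁻ s, f (l • s) ≤ ∫⁻ s, f s := by
  have hl0 : l ≠ 0 := by positivity
  rw [← lintegral_map hf (measurable_const_smul l), Measure.map_addHaar_smul _ hl0,
    lintegral_smul_measure, smul_eq_mul]
  refine mul_le_of_le_one_left' ?_
  rw [ENNReal.ofReal_le_one, abs_of_nonneg (by positivity)]
  exact inv_le_one_of_one_le₀ (one_le_pow₀ hl)

/-- The majorant at coupling `l ≥ 1` is bounded by the rescaled majorant at coupling one. -/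
theorem exists_majorant_le_majorant_one (n : ℕ) :
    ∃ c : ℝ, 0 < c ∧ ∀ l : ℝ, 1 ≤ l → ∀ x v : Fin n → ℝ,
      majorant n l x v ≤ ENNReal.ofReal c * majorant n 1 (l • x) (l⁻¹ • v) := by
  induction n with
  | zero => exact ⟨1, one_pos, fun l _ x v => by simp [majorant]⟩
  | succ n ih =>
    obtain ⟨c, hc, ih⟩ := ih
    refine ⟨(2 : ℝ) ^ (n * (n + 1)) * c, by positivity, fun l hl x v => ?_⟩
    have hl0 : l ≠ 0 := by positivity
    simp only [majorant]
    -- The opposite scalings of x and v leave the plane waves unchanged, so only weight, kernel and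
    -- Jacobian need estimates.
    have e : (l⁻¹ • v) (Fin.last n) * ∑ j, (l • x) j = v (Fin.last n) * ∑ j, x j := by
      simp only [Pi.smul_apply, smul_eq_mul, ← Finset.mul_sum]
      field_simp
    have e2 : dropLast (l⁻¹ • v) = l⁻¹ • dropLast v := by
      ext j; simp [dropLast, mul_sub]
    rw [e, e2, mul_left_comm]
    refine mul_le_mul_right ?_ _
    set f : (Fin n → ℝ) → ℝ≥0∞ := fun s =>
      ENNReal.ofReal (|sinhProd s| ^ (2 * (1 : ℝ)) / coshProd (l • x) s ^ (1 : ℝ)) *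
        majorant n 1 s (l⁻¹ • dropLast v) with hf
    have hfm : Measurable f := (measurable_stepDensity 1 _).mul (measurable_majorant 1 _)
    calc _ ≤ ∫⁻ s, ENNReal.ofReal ((2 : ℝ) ^ (n * (n + 1)) * c) * f (l • s) := by
          refine lintegral_mono fun s => ?_
          simp only [hf]
          rw [ENNReal.ofReal_mul (by positivity), mul_mul_mul_comm]
          refine mul_le_mul' ?_ (ih l hl s _)
          rw [← ENNReal.ofReal_mul (by positivity)]
          refine ENNReal.ofReal_le_ofReal ?_
          have h1 := abs_sinhProd_rpow_le hl s
          have h2 := coshProd_smul_le (zero_le_one.trans hl) x s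
          have h3 := coshProd_pos (l • x) (l • s)
          have h4 := Real.rpow_pos_of_pos (coshProd_pos x s) l
          rw [mul_one, Real.rpow_two, Real.rpow_one, mul_comm 2 l, Real.rpow_mul (abs_nonneg _),
            Real.rpow_two, div_le_iff₀ h4]
          have h5 : (|sinhProd s| ^ l) ^ 2 ≤ |sinhProd (l • s)| ^ 2 :=
            pow_le_pow_left₀ (by positivity) h1 2
          calc (|sinhProd s| ^ l) ^ 2 ≤ |sinhProd (l • s)| ^ 2 * 1 := by simpa using h5
            _ ≤ |sinhProd (l • s)| ^ 2 *
                ((2 : ℝ) ^ (n * (n + 1)) * coshProd x s ^ l / coshProd (l • x) (l • s)) := by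
                refine mul_le_mul_of_nonneg_left ?_ (by positivity)
                rwa [le_div_iff₀ h3, one_mul]
            _ = _ := by ring
      _ = ENNReal.ofReal ((2 : ℝ) ^ (n * (n + 1)) * c) * ∫⁻ s, f (l • s) :=
          lintegral_const_mul' _ _ ENNReal.ofReal_ne_top
      _ ≤ _ := mul_le_mul_right (lintegral_comp_smul_le hl hfm) _

/-- A determinant with entries in [-1, 1] is at most (n + 1)! in absolute value. The lower bound 1
on the constant makes its powers monotone in the exponent. -/
theorem exists_abs_cauchyKernel_le (n : ℕ) :
    ∃ c : ℝ, 1 ≤ c ∧ ∀ (y : Fin (n + 1) → ℝ) (s : Fin n → ℝ), |cauchyKernel y s| ≤ c := by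
  obtain ⟨c, hc, h⟩ := exists_sinhProd_mul_div_coshProd_eq n
  refine ⟨max 1 (c * (n + 1).factorial), le_max_left _ _, fun y s => le_trans ?_ (le_max_right _ _)⟩
  rw [cauchyKernel, h y s 0, abs_mul, abs_of_pos hc, det_bordered]
  refine mul_le_mul_of_nonneg_left ?_ hc.le
  refine (Finset.abs_sum_le_sum_abs _ _).trans ?_
  refine (Finset.sum_le_card_nsmul _ _ 1 fun σ _ => ?_).trans (by simp [Fintype.card_perm])
  rw [abs_mul, Finset.abs_prod]
  refine mul_le_one₀ ?_ (Finset.prod_nonneg fun _ _ => abs_nonneg _)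
    (Finset.prod_le_one (fun _ _ => abs_nonneg _) fun k _ => ?_)
  · rcases Int.units_eq_one_or (Equiv.Perm.sign σ) with h | h <;> simp [h]
  · simpa using (Real.abs_tanh_lt_one _).le

theorem abs_cauchyKernel_rpow {n : ℕ} (l : ℝ) (y : Fin (n + 1) → ℝ) (s : Fin n → ℝ) :
    |cauchyKernel y s| ^ l = |sinhProd y| ^ l * |sinhProd s| ^ l / coshProd y s ^ l := by
  rw [cauchyKernel, abs_div, abs_mul, abs_of_pos (coshProd_pos y s),
    Real.div_rpow (by positivity) (coshProd_pos y s).le, Real.mul_rpow (by positivity)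
      (by positivity)]

theorem rpow_le_rpow_sub_mul {a c l l' : ℝ} (ha : 0 ≤ a) (hac : a ≤ c) (hl' : 0 ≤ l')
    (hl : l' ≤ l) : a ^ l ≤ c ^ (l - l') * a ^ l' := by
  have : a ^ l = a ^ (l - l') * a ^ l' := by
    rw [← Real.rpow_add_of_nonneg ha (sub_nonneg.2 hl) hl', sub_add_cancel]
  rw [this]
  exact mul_le_mul_of_nonneg_right (Real.rpow_le_rpow ha hac (sub_nonneg.2 hl)) (by positivity)

/-- Up to exponential factors in the coupling, `|sinhProd x| ^ l * majorant n l x v` decreases in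
`l`. -/
theorem exists_majorant_mono (n : ℕ) :
    ∃ c : ℝ, 1 ≤ c ∧ ∀ l l' : ℝ, 0 ≤ l' → l' ≤ l → ∀ x v : Fin n → ℝ,
      ENNReal.ofReal (|sinhProd x| ^ l) * majorant n l x v ≤
        ENNReal.ofReal (c ^ (l - l')) *
          (ENNReal.ofReal (|sinhProd x| ^ l') * majorant n l' x v) := by
  induction n with
  | zero => exact ⟨1, le_rfl, fun l l' _ _ x v => by simp [majorant, sinhProd]⟩
  | succ n ih =>
    obtain ⟨c, hc, ih⟩ := ih
    obtain ⟨d, hd, h⟩ := exists_abs_cauchyKernel_le n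
    have hc0 : 0 ≤ c := by positivity
    have hd0 : 0 ≤ d := by positivity
    refine ⟨d * c, by nlinarith, fun l l' hl' hl x v => ?_⟩
    -- Half of the weight joins the outer factor |sinhProd x|^m to form |cauchyKernel|^m. The other
    -- half rebuilds the same quantity with one variable less. The kernel is bounded, so lowering
    -- its exponent costs only a constant power.
    have e : ∀ m : ℝ, 0 ≤ m → ENNReal.ofReal (|sinhProd x| ^ m) * majorant (n + 1) m x v =
        ENNReal.ofReal (Real.exp (-(v (Fin.last n) * ∑ j, x j))) *
          ∫⁻ s : Fin n → ℝ, ENNReal.ofReal (|cauchyKernel x s| ^ m) *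
            (ENNReal.ofReal (|sinhProd s| ^ m) * majorant n m s (dropLast v)) := by
      intro m hm
      rw [majorant, mul_left_comm, ← lintegral_const_mul' _ _ ENNReal.ofReal_ne_top]
      congr 1
      refine lintegral_congr fun s => ?_
      rw [← mul_assoc, ← mul_assoc, ← ENNReal.ofReal_mul (by positivity),
        ← ENNReal.ofReal_mul (by positivity), abs_cauchyKernel_rpow, two_mul,
        Real.rpow_add_of_nonneg (abs_nonneg _) hm hm]
      congr 2
      ring
    rw [e l (hl'.trans hl), e l' hl', mul_left_comm]
    refine mul_le_mul_right ?_ _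
    rw [← lintegral_const_mul' _ _ ENNReal.ofReal_ne_top]
    refine lintegral_mono fun s => ?_
    simp only
    rw [Real.mul_rpow hd0 hc0, ENNReal.ofReal_mul (by positivity), mul_mul_mul_comm]
    refine mul_le_mul' ?_ (ih l l' hl' hl s _)
    rw [← ENNReal.ofReal_mul (by positivity)]
    exact ENNReal.ofReal_le_ofReal (rpow_le_rpow_sub_mul (abs_nonneg _) (h x s) hl' hl)

/-- The majorant is bounded, on the convex hull of finitely many spectral parameters, by the sum of
its values there. -/
theorem majorant_sum_smul_le {ι : Type*} [Fintype ι] {a : ι → ℝ} (ha : ∀ i, 0 ≤ a i)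
    (ha1 : ∑ i, a i = 1) {n : ℕ} (b : ι → ℝ) (l : ℝ) (x : Fin n → ℝ) (w : ι → Fin n → ℝ) :
    ENNReal.ofReal (Real.exp (∑ i, a i * b i)) * majorant n l x (∑ i, a i • w i) ≤
      ∑ i, ENNReal.ofReal (Real.exp (b i)) * majorant n l x (w i) := by
  -- As a function of v the majorant is a positive superposition of exponentials of linear forms.
  -- The numbers b collect the exponents of the outer levels, so that convexity of exp is applied
  -- once, at the bottom.
  induction n generalizing b with
  | zero =>
    simp only [majorant, mul_one]
    rw [← ENNReal.ofReal_sum_of_nonneg fun _ _ => (Real.exp_pos _).le]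
    refine ENNReal.ofReal_le_ofReal ?_
    have := convexOn_exp.map_sum_le (t := Finset.univ) (w := a) (p := b) (fun i _ => ha i) ha1
      fun _ _ => Set.mem_univ _
    simp only [smul_eq_mul] at this
    refine this.trans (Finset.sum_le_sum fun i hi => ?_)
    refine mul_le_of_le_one_left (Real.exp_pos _).le ?_
    rw [← ha1]
    exact Finset.single_le_sum (fun i _ => ha i) hi
  | succ n ih =>
    have hlast : ∀ (c : ℝ) (u : Fin (n + 1) → ℝ),
        ENNReal.ofReal (Real.exp c) * majorant (n + 1) l x u =
          ∫⁻ s : Fin n → ℝ, ENNReal.ofReal (|sinhProd s| ^ (2 * l) / coshProd x s ^ l) *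
            (ENNReal.ofReal (Real.exp (c - u (Fin.last n) * ∑ j, x j)) *
              majorant n l s (dropLast u)) := by
      intro c u
      rw [majorant, ← mul_assoc, ← ENNReal.ofReal_mul (Real.exp_pos _).le, ← Real.exp_add,
        ← sub_eq_add_neg, ← lintegral_const_mul' _ _ ENNReal.ofReal_ne_top]
      exact lintegral_congr fun s => mul_left_comm _ _ _
    simp_rw [hlast]
    have hm : ∀ i ∈ Finset.univ, Measurable fun s : Fin n → ℝ =>
        ENNReal.ofReal (|sinhProd s| ^ (2 * l) / coshProd x s ^ l) *
          (ENNReal.ofReal (Real.exp (b i - w i (Fin.last n) * ∑ j, x j)) *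
            majorant n l s (dropLast (w i))) := fun i _ =>
      (measurable_stepDensity l x).mul ((measurable_majorant l _).const_mul _)
    rw [← lintegral_finsetSum _ hm]
    refine lintegral_mono fun s => ?_
    simp only
    rw [← Finset.mul_sum]
    refine mul_le_mul_right ?_ _
    convert ih (fun i => b i - w i (Fin.last n) * ∑ j, x j) s (fun i => dropLast (w i)) using 4
    · simp only [Finset.sum_apply, Pi.smul_apply, smul_eq_mul, mul_sub, Finset.sum_sub_distrib,
        Finset.sum_mul, mul_assoc]
    · ext j
      simp [dropLast, mul_sub, Finset.sum_sub_distrib]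

/-! ### Translations, and the passage from F to the majorant. -/

/-- A real vector viewed as a complex vector. -/
def ofRealVec {n : ℕ} (s : Fin n → ℝ) : Fin n → ℂ := fun j => (s j : ℂ)

theorem contour_zero {n : ℕ} (s : Fin n → ℝ) : contour 0 s = ofRealVec s := by
  ext j; simp [contour, ofRealVec]

theorem weight_add_const {n : ℕ} (lam : ℂ) (s : Fin n → ℂ) (c : ℂ) :
    weight lam (fun j => s j + c) = weight lam s := by
  simp [weight]

theorem kernel_add_const {n : ℕ} (lam : ℂ) (t : Fin (n + 1) → ℂ) (s : Fin n → ℂ) (c : ℂ) :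
    kernel lam (fun j => t j + c) (fun j => s j + c) = kernel lam t s := by
  simp [kernel]

theorem midHeight_add_const {n : ℕ} (t : Fin (n + 1) → ℂ) (c : ℂ) :
    midHeight (fun j => t j + c) = midHeight t + c.im := by
  have h1 := ciSup_add (Set.finite_range fun j => (t j).im).bddAbove c.im
  have h2 := ciInf_add (Set.finite_range fun j => (t j).im).bddBelow c.im
  simp only [midHeight, Complex.add_im]
  rw [← h1, ← h2]
  ring

/-- Weight and kernel depend on differences only. The real part of c translates the integration
variables and its imaginary part raises the contour. -/
theorem stepIntegrand_add_const {n : ℕ} {G : (Fin n → ℂ) → (Fin n → ℂ) → ℂ}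
    (hG : ∀ s u c, G (fun j => s j + c) u = Complex.exp (Complex.I * c * ∑ j, u j) * G s u)
    (lam : ℂ) (t u : Fin (n + 1) → ℂ) (m : ℝ) (c : ℂ) (s : Fin n → ℝ) :
    stepIntegrand G lam (fun j => t j + c) u (m + c.im) (fun j => s j + c.re) =
      Complex.exp (Complex.I * c * ∑ j, dropLast u j) * stepIntegrand G lam t u m s := by
  have h : contour (m + c.im) (fun j => s j + c.re) = fun j => contour m s j + c := by
    ext j
    apply Complex.ext <;> simp [contour]
  rw [stepIntegrand, h, weight_add_const, kernel_add_const, hG, stepIntegrand]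
  simp only [dropLast]
  ring

/-- A translation of all variables multiplies `F` by a plane wave. -/
theorem F_add_const {n : ℕ} (lam : ℂ) (t u : Fin n → ℂ) (c : ℂ) :
    F n lam (fun j => t j + c) u = Complex.exp (Complex.I * c * ∑ j, u j) * F n lam t u := by
  induction n generalizing c with
  | zero => simp [F]
  | succ n ih =>
    rw [F, F, midHeight_add_const, ← integral_add_right_eq_self _ (fun _ : Fin n => c.re)]
    have := fun s : Fin n → ℝ => stepIntegrand_add_const (fun s u c => ih s u c) lam t u
      (midHeight t) c s
    change _ * ∫ s : Fin n → ℝ, stepIntegrand (F n lam) lam (fun j => t j + c) u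
      (midHeight t + c.im) (fun j => s j + c.re) = _
    simp_rw [this]
    rw [integral_const_mul]
    have e : Complex.exp (Complex.I * u (Fin.last n) * ∑ j, (t j + c)) *
        Complex.exp (Complex.I * c * ∑ j, dropLast u j) =
        Complex.exp (Complex.I * c * ∑ j, u j) *
          Complex.exp (Complex.I * u (Fin.last n) * ∑ j, t j) := by
      rw [← Complex.exp_add, ← Complex.exp_add]
      congr 1
      simp only [dropLast, Finset.sum_add_distrib, Finset.sum_sub_distrib, Fin.sum_univ_castSucc u,
        Finset.sum_const, Finset.card_univ, Fintype.card_fin, nsmul_eq_mul]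
      push_cast
      ring
    rw [← mul_assoc, div_mul_eq_mul_div, e]
    ring

/-- The integrand on the contour at height `c` in terms of the integrand on the real contour. -/
theorem stepIntegrand_eq_stepIntegrand_zero {n : ℕ} (lam : ℂ) (t u : Fin (n + 1) → ℂ) (c : ℝ)
    (s : Fin n → ℝ) :
    stepIntegrand (F n lam) lam t u c s = Complex.exp (Complex.I * (Complex.I * c) *
      ∑ j, dropLast u j) * stepIntegrand (F n lam) lam (fun j => t j - Complex.I * c) u 0 s := by
  have := stepIntegrand_add_const (fun s u c => F_add_const lam s u c) lam
    (fun j => t j - Complex.I * c) u 0 (Complex.I * c) s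
  simpa using this

theorem weight_ofRealVec {n : ℕ} (lam : ℂ) (s : Fin n → ℝ) :
    weight lam (ofRealVec s) =
      ∏ j, ∏ k ∈ Finset.Ioi j, (((2 * Real.sinh (s j - s k)) ^ 2 : ℝ) : ℂ) ^ lam := by
  simp only [weight, ofRealVec]
  push_cast
  refine Finset.prod_congr rfl fun j _ => Finset.prod_congr rfl fun k _ => ?_
  congr 1
  ring

theorem norm_weight_ofRealVec {n : ℕ} {lam : ℂ} (hl : lam.re ≠ 0) (s : Fin n → ℝ) :
    ‖weight lam (ofRealVec s)‖ = |sinhProd s| ^ (2 * lam.re) := by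
  rw [weight_ofRealVec]
  simp only [norm_prod, sinhProd, Finset.abs_prod]
  rw [← Real.finsetProd_rpow _ _ fun _ _ => Finset.prod_nonneg fun _ _ => abs_nonneg _]
  refine Finset.prod_congr rfl fun j _ => ?_
  rw [← Real.finsetProd_rpow _ _ fun _ _ => abs_nonneg _]
  refine Finset.prod_congr rfl fun k _ => ?_
  rw [Complex.norm_cpow_eq_rpow_re_of_nonneg (sq_nonneg _) hl, Real.rpow_mul (abs_nonneg _),
    Real.rpow_two, sq_abs]

theorem re_cosh (z : ℂ) : (Complex.cosh z).re = Real.cosh z.re * Real.cos z.im := by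
  conv_lhs => rw [← Complex.re_add_im z, Complex.cosh_add]
  simp [Complex.cosh_mul_I, Complex.sinh_mul_I, ← Complex.ofReal_cosh, ← Complex.ofReal_cos,
    ← Complex.ofReal_sinh, ← Complex.ofReal_sin]

/-- Re cosh z = cosh(Re z) cos(Im z) bounds the modulus of the base from below. Its argument, at
most π, accounts for the exponential in Im λ. -/
theorem norm_two_mul_cosh_cpow_le {lam z : ℂ} {μ : ℝ} (hl : 0 ≤ lam.re) (hz : |z.im| ≤ μ)
    (hμ : μ < Real.pi / 2) :
    ‖(2 * Complex.cosh z) ^ (-lam)‖ ≤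
      Real.exp (Real.pi * |lam.im|) * Real.cos μ ^ (-lam.re) *
        (2 * Real.cosh z.re) ^ (-lam.re) := by
  have hμ0 : 0 ≤ μ := (abs_nonneg _).trans hz
  have hcos : 0 < Real.cos μ := Real.cos_pos_of_mem_Ioo ⟨by linarith, hμ⟩
  have hcos' : Real.cos μ ≤ Real.cos z.im := by
    rw [← Real.cos_abs z.im]
    exact Real.cos_le_cos_of_nonneg_of_le_pi (abs_nonneg _) (by linarith [Real.pi_pos]) hz
  have hlow : Real.cos μ * (2 * Real.cosh z.re) ≤ ‖2 * Complex.cosh z‖ := by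
    refine le_trans ?_ (Complex.re_le_norm _)
    have : (2 * Complex.cosh z).re = 2 * (Real.cosh z.re * Real.cos z.im) := by
      simp [← re_cosh]
    rw [this]
    have := mul_le_mul_of_nonneg_left hcos' (Real.cosh_pos z.re).le
    linarith
  have hpos : 0 < Real.cos μ * (2 * Real.cosh z.re) := by
    have := Real.cosh_pos z.re
    positivity
  have hne : 2 * Complex.cosh z ≠ 0 := norm_pos_iff.1 (hpos.trans_le hlow)
  rw [Complex.norm_cpow_of_ne_zero hne, mul_assoc, ← Real.mul_rpow hcos.le
    (mul_pos two_pos (Real.cosh_pos _)).le, div_eq_inv_mul, ← Real.exp_neg]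
  refine mul_le_mul ?_ ?_ (by positivity) (Real.exp_pos _).le
  · rw [Real.exp_le_exp]
    calc _ ≤ |-(Complex.arg (2 * Complex.cosh z) * (-lam).im)| := le_abs_self _
      _ = |Complex.arg (2 * Complex.cosh z)| * |lam.im| := by simp [abs_mul]
      _ ≤ _ := mul_le_mul_of_nonneg_right (Complex.abs_arg_le_pi _) (abs_nonneg _)
  · rw [Complex.neg_re]
    exact Real.rpow_le_rpow_of_nonpos hpos hlow (neg_nonpos.2 hl)

theorem coshProd_rpow_neg {n : ℕ} (x : Fin (n + 1) → ℝ) (s : Fin n → ℝ) (l : ℝ) :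
    (coshProd x s ^ l)⁻¹ = ∏ j, ∏ k, (2 * Real.cosh (x j - s k)) ^ (-l) := by
  have hc : ∀ j k, 0 ≤ 2 * Real.cosh (x j - s k) := fun j k =>
    (mul_pos two_pos (Real.cosh_pos _)).le
  rw [← Real.rpow_neg (coshProd_pos x s).le, coshProd, ← Real.finsetProd_rpow _ _ fun _ _ =>
    Finset.prod_nonneg fun _ _ => hc _ _]
  refine Finset.prod_congr rfl fun j _ => ?_
  rw [← Real.finsetProd_rpow _ _ fun _ _ => hc _ _]

/-- The factor by which the kernel can exceed its value at real arguments. -/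
def kernelFactor (n : ℕ) (lam : ℂ) (μ : ℝ) : ℝ :=
  (Real.exp (Real.pi * |lam.im|) * Real.cos μ ^ (-lam.re)) ^ (n * (n + 1))

theorem norm_kernel_le {n : ℕ} {lam : ℂ} {μ : ℝ} (hl : 0 ≤ lam.re) {t : Fin (n + 1) → ℂ}
    (ht : ∀ j, |(t j).im| ≤ μ) (hμ : μ < Real.pi / 2) (s : Fin n → ℝ) :
    ‖kernel lam t (ofRealVec s)‖ ≤
      kernelFactor n lam μ * (coshProd (fun j => (t j).re) s ^ lam.re)⁻¹ := by
  have e : kernelFactor n lam μ = ∏ _j : Fin (n + 1), ∏ _k : Fin n,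
      (Real.exp (Real.pi * |lam.im|) * Real.cos μ ^ (-lam.re)) := by
    simp [kernelFactor, pow_mul]
  rw [coshProd_rpow_neg, e, ← Finset.prod_mul_distrib]
  simp_rw [← Finset.prod_mul_distrib, kernel, norm_prod]
  refine Finset.prod_le_prod (fun _ _ => Finset.prod_nonneg fun _ _ => norm_nonneg _) fun j _ =>
    Finset.prod_le_prod (fun _ _ => norm_nonneg _) fun k _ => ?_
  have := norm_two_mul_cosh_cpow_le (z := t j - ofRealVec s k) hl (by simpa [ofRealVec] using ht j)
    hμ
  simpa [ofRealVec] using this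

theorem norm_kernel_ofRealVec {n : ℕ} (lam : ℂ) (x : Fin (n + 1) → ℝ) (s : Fin n → ℝ) :
    ‖kernel lam (ofRealVec x) (ofRealVec s)‖ = (coshProd x s ^ lam.re)⁻¹ := by
  rw [coshProd_rpow_neg]
  simp only [kernel, norm_prod]
  refine Finset.prod_congr rfl fun j _ => Finset.prod_congr rfl fun k _ => ?_
  have : 2 * Complex.cosh (ofRealVec x j - ofRealVec s k) =
      ((2 * Real.cosh (x j - s k) : ℝ) : ℂ) := by
    simp [ofRealVec]
  rw [this, Complex.norm_cpow_eq_rpow_re_of_pos (mul_pos two_pos (Real.cosh_pos _))]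
  simp

theorem stepIntegrand_zero {n : ℕ} (G : (Fin n → ℂ) → (Fin n → ℂ) → ℂ) (lam : ℂ)
    (t u : Fin (n + 1) → ℂ) (s : Fin n → ℝ) :
    stepIntegrand G lam t u 0 s =
      weight lam (ofRealVec s) * kernel lam t (ofRealVec s) * G (ofRealVec s) (dropLast u) := by
  rw [stepIntegrand, contour_zero]; rfl

theorem midHeight_ofRealVec {n : ℕ} (x : Fin n → ℝ) : midHeight (ofRealVec x) = 0 := by
  simp [midHeight, ofRealVec]

theorem dropLast_im {n : ℕ} (u : Fin (n + 1) → ℂ) :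
    (fun j => (dropLast u j).im) = dropLast fun j => (u j).im := by
  ext j; simp [dropLast]

/-- For real variables, `F` is bounded by the majorant. -/
theorem enorm_F_ofRealVec_le {n : ℕ} {lam : ℂ} (hl : lam.re ≠ 0) (x : Fin n → ℝ) (u : Fin n → ℂ) :
    ‖F n lam (ofRealVec x) u‖ₑ ≤ majorant n lam.re x fun j => (u j).im := by
  induction n with
  | zero => simp [F, majorant]
  | succ n ih =>
    rw [F, majorant, midHeight_ofRealVec, enorm_mul]
    refine mul_le_mul' ?_ ((enorm_integral_le_lintegral_enorm _).trans (lintegral_mono fun s => ?_))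
    · rw [← ofReal_norm]
      refine ENNReal.ofReal_le_ofReal ?_
      rw [norm_div, Complex.norm_exp, Complex.norm_natCast]
      refine (div_le_self (Real.exp_pos _).le
        (by exact_mod_cast Nat.one_le_iff_ne_zero.2 n.factorial_ne_zero)).trans_eq ?_
      congr 1
      simp [ofRealVec, ← Complex.ofReal_sum]
    · rw [stepIntegrand_zero, enorm_mul]
      refine mul_le_mul' ?_ ?_
      · rw [← ofReal_norm, norm_mul, norm_weight_ofRealVec hl, norm_kernel_ofRealVec,
          div_eq_mul_inv]
      · rw [← dropLast_im]
        exact ih s _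

/-- On the real contour the imaginary part of t enters only the kernel. The inner F is evaluated at
real points, where the majorant applies. -/
theorem enorm_stepIntegrand_le {n : ℕ} {lam : ℂ} {μ : ℝ} (hl : 0 < lam.re)
    {t : Fin (n + 1) → ℂ} (ht : ∀ j, |(t j).im| ≤ μ) (hμ : μ < Real.pi / 2)
    (u : Fin (n + 1) → ℂ) (s : Fin n → ℝ) :
    ‖stepIntegrand (F n lam) lam t u 0 s‖ₑ ≤ ENNReal.ofReal (kernelFactor n lam μ) *
      (ENNReal.ofReal (|sinhProd s| ^ (2 * lam.re) / coshProd (fun j => (t j).re) s ^ lam.re) *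
        majorant n lam.re s (dropLast fun j => (u j).im)) := by
  have hk : 0 ≤ kernelFactor n lam μ := by
    have hμ0 : 0 ≤ μ := (abs_nonneg _).trans (ht 0)
    have := Real.cos_nonneg_of_neg_pi_div_two_le_of_le (x := μ) (by linarith) hμ.le
    unfold kernelFactor
    positivity
  rw [stepIntegrand_zero, enorm_mul, ← mul_assoc, ← ENNReal.ofReal_mul hk]
  refine mul_le_mul' ?_ ?_
  · rw [← ofReal_norm, norm_mul, norm_weight_ofRealVec hl.ne']
    refine ENNReal.ofReal_le_ofReal ?_
    refine (mul_le_mul_of_nonneg_left (norm_kernel_le hl.le ht hμ s) (by positivity)).trans_eq ?_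
    ring
  · rw [← dropLast_im]
    exact enorm_F_ofRealVec_le hl.ne' s _

/-! ### Local domination of the integrand. -/

theorem majorant_ne_top {n : ℕ} {l : ℝ} (hl : 1 ≤ l) {x w : Fin n → ℝ}
    (hx : Function.Injective x) (hw : ∀ j k, j ≠ k → w j ≠ w k)
    (hw2 : ∀ j k, |w j - w k| < 2 * l) : majorant n l x w ≠ ∞ := by
  obtain ⟨c, hc, h⟩ := exists_majorant_le_majorant_one n
  obtain ⟨d, hd, h'⟩ := exists_majorant_one_eq n
  have hl0 : 0 < l := by positivity
  refine ((h l hl x w).trans_lt ?_).ne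
  rw [(h' (l • x) (l⁻¹ • w) (fun j k hjk => hx (by simpa [hl0.ne'] using hjk))
    (fun j k hjk => by simpa [hl0.ne'] using hw j k hjk) fun j k => ?_).2]
  · exact ENNReal.mul_lt_top ENNReal.ofReal_lt_top ENNReal.ofReal_lt_top
  · rw [Pi.smul_apply, Pi.smul_apply, smul_eq_mul, smul_eq_mul, ← mul_sub, abs_mul,
      abs_of_pos (inv_pos.2 hl0), inv_mul_lt_iff₀ hl0]
    linarith [hw2 j k]

theorem cosh_le_exp_mul_cosh {a b M : ℝ} (h : |a - b| ≤ M) :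
    Real.cosh b ≤ Real.exp M * Real.cosh a := by
  obtain ⟨h1, h2⟩ := abs_le.1 h
  have e1 : Real.exp b ≤ Real.exp M * Real.exp a := by
    rw [← Real.exp_add, Real.exp_le_exp]; linarith
  have e2 : Real.exp (-b) ≤ Real.exp M * Real.exp (-a) := by
    rw [← Real.exp_add, Real.exp_le_exp]; linarith
  rw [Real.cosh_eq, Real.cosh_eq]
  linarith

theorem coshProd_le_of_abs_sub_le {n : ℕ} {x z : Fin (n + 1) → ℝ} {M : ℝ}
    (h : ∀ j, |x j - z j| ≤ M) (s : Fin n → ℝ) :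
    coshProd z s ≤ Real.exp M ^ (n * (n + 1)) * coshProd x s := by
  have e : Real.exp M ^ (n * (n + 1)) = ∏ _j : Fin (n + 1), ∏ _k : Fin n, Real.exp M := by
    simp [pow_mul]
  rw [e, coshProd, coshProd, ← Finset.prod_mul_distrib]
  simp_rw [← Finset.prod_mul_distrib]
  have hc : ∀ a, 0 ≤ 2 * Real.cosh a := fun a => (mul_pos two_pos (Real.cosh_pos _)).le
  refine Finset.prod_le_prod (fun _ _ => Finset.prod_nonneg fun _ _ => hc _) fun j _ =>
    Finset.prod_le_prod (fun _ _ => hc _) fun k _ => ?_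
  have := cosh_le_exp_mul_cosh (a := x j - s k) (b := z j - s k) (M := M) (by simpa using h j)
  linarith

/-- The integrand in the recursion for the majorant is controlled by the one at a smaller coupling
and at fixed variables `z`. -/
theorem exists_stepDensity_mul_majorant_le {n : ℕ} {z : Fin (n + 1) → ℝ}
    (hz : Function.Injective z) (M : ℝ) :
    ∃ K : ℝ, 1 ≤ K ∧ ∀ l l' : ℝ, 0 ≤ l' → l' ≤ l → ∀ x : Fin (n + 1) → ℝ,
      (∀ j, |x j - z j| ≤ M) → ∀ s v : Fin n → ℝ,
      ENNReal.ofReal (|sinhProd s| ^ (2 * l) / coshProd x s ^ l) * majorant n l s v ≤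
        ENNReal.ofReal (K ^ l) *
          (ENNReal.ofReal (|sinhProd s| ^ (2 * l') / coshProd z s ^ l') * majorant n l' s v) := by
  obtain ⟨c, hc, hmono⟩ := exists_majorant_mono n
  obtain ⟨E, hE, hker⟩ := exists_abs_cauchyKernel_le n
  have hz0 := abs_pos.2 (sinhProd_ne_zero hz)
  set A : ℝ := max 1 (Real.exp M ^ (n * (n + 1))) with hA
  set B : ℝ := max 1 (E / |sinhProd z|) with hB
  have hA1 : 1 ≤ A := le_max_left _ _
  have hB1 : 1 ≤ B := le_max_left _ _
  refine ⟨c * (A * B), one_le_mul_of_one_le_of_one_le hc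
    (one_le_mul_of_one_le_of_one_le hA1 hB1), fun l l' hl' hl x hx s v => ?_⟩
  have hS := abs_nonneg (sinhProd s)
  have hCx := coshProd_pos x s
  have hCz := coshProd_pos z s
  -- Half of the weight is kept with the kernel, to be bounded by the Cauchy kernel. The other half
  -- is what `exists_majorant_mono` requires.
  have hsplit : ∀ (m : ℝ) (y : Fin (n + 1) → ℝ), 0 ≤ m →
      ENNReal.ofReal (|sinhProd s| ^ (2 * m) / coshProd y s ^ m) * majorant n m s v =
        ENNReal.ofReal ((|sinhProd s| / coshProd y s) ^ m) *
          (ENNReal.ofReal (|sinhProd s| ^ m) * majorant n m s v) := by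
    intro m y hm
    have hCy := coshProd_pos y s
    rw [← mul_assoc, ← ENNReal.ofReal_mul (by positivity), Real.div_rpow hS hCy.le, two_mul,
      Real.rpow_add_of_nonneg hS hm hm]
    congr 2
    ring
  rw [hsplit l x (hl'.trans hl), hsplit l' z hl']
  have h1 : |sinhProd s| / coshProd x s ≤ A * (|sinhProd s| / coshProd z s) := by
    rw [mul_div_assoc', div_le_div_iff₀ hCx hCz]
    have h2 := coshProd_le_of_abs_sub_le hx s
    have h3 : coshProd z s ≤ A * coshProd x s :=
      h2.trans (mul_le_mul_of_nonneg_right (le_max_right _ _) hCx.le)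
    calc |sinhProd s| * coshProd z s ≤ |sinhProd s| * (A * coshProd x s) :=
          mul_le_mul_of_nonneg_left h3 hS
      _ = _ := by ring
  -- This is the bounded Cauchy kernel divided by `sinhProd z`, which is nonzero because z has
  -- distinct entries.
  have h2 : |sinhProd s| / coshProd z s ≤ B := by
    refine le_trans ?_ (le_max_right _ _)
    rw [le_div_iff₀ hz0]
    have := hker z s
    rw [cauchyKernel, abs_div, abs_mul, abs_of_pos hCz] at this
    calc _ = |sinhProd z| * |sinhProd s| / coshProd z s := by ring
      _ ≤ E := this
  have hA0 : 0 ≤ A := zero_le_one.trans hA1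
  have hB0 : 0 ≤ B := zero_le_one.trans hB1
  have hc0 : 0 ≤ c := zero_le_one.trans hc
  have h3 : (|sinhProd s| / coshProd x s) ^ l ≤
      (A * B) ^ (l - l') * A ^ l' * (|sinhProd s| / coshProd z s) ^ l' := by
    have hk0 : 0 ≤ |sinhProd s| / coshProd z s := by positivity
    calc _ ≤ (A * (|sinhProd s| / coshProd z s)) ^ l :=
          Real.rpow_le_rpow (by positivity) h1 (hl'.trans hl)
      _ ≤ (A * B) ^ (l - l') * (A * (|sinhProd s| / coshProd z s)) ^ l' :=
          rpow_le_rpow_sub_mul (by positivity) (mul_le_mul_of_nonneg_left h2 hA0) hl' hl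
      _ = _ := by rw [Real.mul_rpow hA0 hk0, mul_assoc]
  have h4 : (A * B) ^ (l - l') * A ^ l' * c ^ (l - l') ≤ (c * (A * B)) ^ l := by
    have e1 : A ^ l' ≤ (A * B) ^ l' :=
      Real.rpow_le_rpow hA0 (le_mul_of_one_le_right hA0 hB1) hl'
    have e2 : c ^ (l - l') ≤ c ^ l := Real.rpow_le_rpow_of_exponent_le hc (by linarith)
    calc _ ≤ (A * B) ^ (l - l') * (A * B) ^ l' * c ^ l := by gcongr
      _ = (A * B) ^ l * c ^ l := by
          rw [← Real.rpow_add_of_nonneg (by positivity) (sub_nonneg.2 hl) hl', sub_add_cancel]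
      _ = _ := by rw [Real.mul_rpow hc0 (by positivity), mul_comm]
  have hrest : 0 ≤ (A * B) ^ (l - l') * A ^ l' := by positivity
  calc _ ≤ ENNReal.ofReal ((A * B) ^ (l - l') * A ^ l' * (|sinhProd s| / coshProd z s) ^ l') *
        (ENNReal.ofReal (c ^ (l - l')) *
          (ENNReal.ofReal (|sinhProd s| ^ l') * majorant n l' s v)) :=
        mul_le_mul' (ENNReal.ofReal_le_ofReal h3) (hmono l l' hl' hl s v)
    _ = ENNReal.ofReal ((A * B) ^ (l - l') * A ^ l' * c ^ (l - l')) *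
        (ENNReal.ofReal ((|sinhProd s| / coshProd z s) ^ l') *
          (ENNReal.ofReal (|sinhProd s| ^ l') * majorant n l' s v)) := by
        rw [ENNReal.ofReal_mul hrest, ENNReal.ofReal_mul hrest]
        ring
    _ ≤ _ := mul_le_mul_left (ENNReal.ofReal_le_ofReal h4) _

/-- Around every point there are arbitrarily small boxes whose vertices have distinct entries. -/
theorem exists_box_generic {n : ℕ} {l : ℝ} (v : Fin n → ℝ) (hv : ∀ j k, |v j - v k| < 2 * l) :
    ∃ η : ℝ, 0 < η ∧ ∃ V : Finset (Fin n → ℝ),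
      (∀ w ∈ V, (∀ j k, j ≠ k → w j ≠ w k) ∧ ∀ j k, |w j - w k| < 2 * l) ∧
      ∀ v', (∀ j, |v' j - v j| ≤ η) → v' ∈ convexHull ℝ (V : Set (Fin n → ℝ)) := by
  classical
  -- The vertices are v_j ± η(j + 1). Where v_j = v_k the distinct half-widths separate the entries,
  -- whatever the signs; where v_j ≠ v_k a small η keeps them apart.
  have key : ∀ᶠ η : ℝ in 𝓝[>] 0, ∀ j k : Fin n, ∀ a ∈ ({1, -1} : Finset ℝ),
      ∀ b ∈ ({1, -1} : Finset ℝ),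
      (j ≠ k → v j - v k + η * (a * (j + 1) - b * (k + 1)) ≠ 0) ∧
        |v j - v k + η * (a * (j + 1) - b * (k + 1))| < 2 * l := by
    simp only [eventually_all, Finset.eventually_all]
    intro j k a ha b hb
    have hcont : Tendsto (fun η : ℝ => v j - v k + η * (a * (j + 1) - b * (k + 1))) (𝓝[>] 0)
        (𝓝 (v j - v k)) := by
      refine tendsto_nhdsWithin_of_tendsto_nhds ?_
      have : Continuous fun η : ℝ => v j - v k + η * (a * (j + 1) - b * (k + 1)) := by fun_prop
      simpa using this.tendsto 0
    refine Filter.Eventually.and ?_ (hcont.abs.eventually_lt_const (hv j k))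
    by_cases hjk : j = k
    · simp [hjk]
    by_cases h : v j = v k
    · filter_upwards [self_mem_nhdsWithin] with η hη _
      rw [h, sub_self, zero_add]
      refine mul_ne_zero (ne_of_gt hη) fun h0 => hjk ?_
      have hj : (0 : ℝ) < j + 1 := by positivity
      have hk : (0 : ℝ) < k + 1 := by positivity
      simp only [Finset.mem_insert, Finset.mem_singleton] at ha hb
      have : (j : ℝ) = k := by
        rcases ha with rfl | rfl <;> rcases hb with rfl | rfl <;> linarith
      exact Fin.ext (by exact_mod_cast this)
    · exact (hcont.eventually_ne (sub_ne_zero.2 h)).mono fun η h _ => h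
  obtain ⟨η, hη, hη0⟩ := (key.and self_mem_nhdsWithin).exists
  have hη0 : 0 < η := hη0
  refine ⟨η, hη0, Fintype.piFinset fun j => {v j - η * (j + 1), v j + η * (j + 1)}, ?_, ?_⟩
  · intro w hw
    have hw' : ∀ j, ∃ a ∈ ({1, -1} : Finset ℝ), w j = v j + η * (a * (j + 1)) := by
      intro j
      have := Fintype.mem_piFinset.1 hw j
      simp only [Finset.mem_insert, Finset.mem_singleton] at this
      rcases this with h | h
      · exact ⟨-1, by simp, by rw [h]; ring⟩
      · exact ⟨1, by simp, by rw [h]; ring⟩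
    refine ⟨fun j k hjk h => ?_, fun j k => ?_⟩
    · obtain ⟨a, ha, ha'⟩ := hw' j
      obtain ⟨b, hb, hb'⟩ := hw' k
      refine (hη j k a ha b hb).1 hjk ?_
      rw [ha', hb'] at h
      linarith
    · obtain ⟨a, ha, ha'⟩ := hw' j
      obtain ⟨b, hb, hb'⟩ := hw' k
      convert (hη j k a ha b hb).2 using 2
      rw [ha', hb']; ring
  · intro v' hv'
    rw [Fintype.coe_piFinset, convexHull_pi, Set.mem_univ_pi]
    intro j
    have h1 := abs_le.1 (hv' j)
    have h2 : η ≤ η * (j + 1) := le_mul_of_one_le_right hη0.le (by simp)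
    rw [Finset.coe_insert, Finset.coe_singleton, convexHull_pair, segment_eq_Icc (by linarith)]
    constructor <;> linarith [h1.1, h1.2]

theorem majorant_le_sum_of_mem_convexHull {n : ℕ} {V : Finset (Fin (n + 1) → ℝ)}
    {v : Fin (n + 1) → ℝ} (hv : v ∈ convexHull ℝ (V : Set (Fin (n + 1) → ℝ))) (l : ℝ)
    (s : Fin n → ℝ) :
    majorant n l s (dropLast v) ≤ ∑ w ∈ V, majorant n l s (dropLast w) := by
  obtain ⟨a, ha, ha1, hav⟩ := Finset.mem_convexHull'.1 hv
  have := majorant_sum_smul_le (ι := V) (a := fun w => a w) (fun w => ha w w.2)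
    (by rw [← ha1]; exact Finset.sum_coe_sort V a) (fun _ => 0) l s fun w => dropLast (w : _ → ℝ)
  simp only [mul_zero, Finset.sum_const_zero, Real.exp_zero, ENNReal.ofReal_one, one_mul] at this
  rw [Finset.sum_coe_sort V fun w => majorant n l s (dropLast w)] at this
  convert this using 2
  rw [Finset.sum_coe_sort V fun w => a w • dropLast w, ← hav]
  ext j
  simp [dropLast, mul_sub, Finset.sum_sub_distrib]

/-- The parameters for which the integrand over the real contour is integrable. -/
def realContourDomain (n : ℕ) : Set (ℂ × (Fin (n + 1) → ℂ) × (Fin (n + 1) → ℂ)) :=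
  {p | 1 ≤ p.1.re ∧ (∀ j, |(p.2.1 j).im| < Real.pi / 2) ∧
    ∀ j k, |(p.2.2 j - p.2.2 k).im| < 2 * p.1.re}

/-- The dominating coupling must be at least 1 and at most every nearby admissible coupling, without
losing the strict bounds on d. At l = 1 the only choice is 1 itself, hence the neighbourhood within
[1, ∞). -/
theorem exists_coupling_le {ι : Type*} [Finite ι] {l : ℝ} (hl : 1 ≤ l) {d : ι → ℝ}
    (hd : ∀ i, d i < 2 * l) :
    ∃ l', 1 ≤ l' ∧ (∀ i, d i < 2 * l') ∧ ∀ᶠ m in 𝓝[Set.Ici 1] l, l' ≤ m := by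
  rcases hl.eq_or_lt with rfl | hl
  · exact ⟨1, le_rfl, hd, self_mem_nhdsWithin⟩
  · have h1 : ∀ᶠ l' in 𝓝[<] l, 1 < l' := tendsto_nhdsWithin_of_tendsto_nhds tendsto_id
      |>.eventually_const_lt hl
    have h2 : ∀ᶠ l' in 𝓝[<] l, ∀ i, d i < 2 * l' := by
      rw [eventually_all]
      intro i
      have : Tendsto (fun l' : ℝ => 2 * l') (𝓝[<] l) (𝓝 (2 * l)) :=
        tendsto_nhdsWithin_of_tendsto_nhds (Continuous.tendsto (by fun_prop) l)
      exact this.eventually_const_lt (hd i)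
    obtain ⟨l', ⟨h1, h2⟩, h3⟩ := ((h1.and h2).and self_mem_nhdsWithin).exists
    exact ⟨l', h1.le, h2, mem_nhdsWithin_of_mem_nhds
      ((tendsto_id.eventually_const_lt h3).mono fun _ h => le_of_lt h)⟩

/-- Local domination of the integrand over the real contour. -/
theorem exists_integrable_bound {n : ℕ} {p₀ : ℂ × (Fin (n + 1) → ℂ) × (Fin (n + 1) → ℂ)}
    (hp₀ : p₀ ∈ realContourDomain n) :
    ∃ Z ∈ 𝓝[realContourDomain n] p₀, ∃ bound : (Fin n → ℝ) → ℝ, Integrable bound ∧ ∀ᵐ s : Fin n → ℝ, ∀ p ∈ Z,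
      ‖stepIntegrand (F n p.1) p.1 p.2.1 p.2.2 0 s‖ ≤ bound s := by
  obtain ⟨hl₀, ht₀, hu₀⟩ := hp₀
  obtain ⟨l', hl'1, hul', hev⟩ := exists_coupling_le (ι := Fin (n + 1) × Fin (n + 1)) hl₀
    (d := fun i => |(p₀.2.2 i.1 - p₀.2.2 i.2).im|) fun i => hu₀ _ _
  obtain ⟨η, hη, V, hV, hVhull⟩ := exists_box_generic (l := l') (fun j => (p₀.2.2 j).im)
    fun j k => by simpa using hul' (j, k)
  obtain ⟨μ, hμ, hμ'⟩ : ∃ μ, (∀ j, |(p₀.2.1 j).im| < μ) ∧ μ < Real.pi / 2 := by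
    have h1 : ∀ᶠ μ in 𝓝[<] (Real.pi / 2), ∀ j, |(p₀.2.1 j).im| < μ := by
      rw [eventually_all]
      exact fun j => tendsto_nhdsWithin_of_tendsto_nhds tendsto_id
        |>.eventually_const_lt (ht₀ j)
    exact (h1.and self_mem_nhdsWithin).exists
  -- Any z with distinct entries will do. The base point itself is unsuitable, since the real parts
  -- of its t may coincide.
  set z : Fin (n + 1) → ℝ := fun j => (j : ℝ)
  have hz : Function.Injective z := fun j k h => Fin.ext (Nat.cast_injective (R := ℝ) h)
  set M : ℝ := ∑ j, |(p₀.2.1 j).re - z j| + 1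
  obtain ⟨K, hK, hKb⟩ := exists_stepDensity_mul_majorant_le hz M
  have hcos : 0 < Real.cos μ :=
    Real.cos_pos_of_mem_Ioo ⟨by linarith [abs_nonneg (p₀.2.1 0).im, hμ 0, Real.pi_pos], hμ'⟩
  set C : ℝ := kernelFactor n p₀.1 μ + 1
  set B : (Fin n → ℝ) → ℝ≥0∞ := fun s => ENNReal.ofReal (C * K ^ (p₀.1.re + 1)) *
    ∑ w ∈ V, ENNReal.ofReal (|sinhProd s| ^ (2 * l') / coshProd z s ^ l') *
      majorant n l' s (dropLast w) with hB
  have hterm : ∀ w ∈ V, Measurable fun s : Fin n → ℝ =>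
      ENNReal.ofReal (|sinhProd s| ^ (2 * l') / coshProd z s ^ l') *
      majorant n l' s (dropLast w) := fun w _ =>
    (measurable_stepDensity l' z).mul (measurable_majorant l' _)
  have hBm : Measurable B := (Finset.measurable_fun_sum V hterm).const_mul _
  have hBi : ∫⁻ s, B s ≠ ∞ := by
    rw [hB, lintegral_const_mul' _ _ ENNReal.ofReal_ne_top, lintegral_finsetSum _ hterm]
    refine ENNReal.mul_ne_top ENNReal.ofReal_ne_top (ENNReal.sum_ne_top.2 fun w hw h => ?_)
    refine majorant_ne_top hl'1 hz (hV w hw).1 (hV w hw).2 ?_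
    rw [majorant, h, ENNReal.mul_top (by simpa using Real.exp_pos _)]
  have hle : 𝓝[realContourDomain n] p₀ ≤ 𝓝 p₀ := nhdsWithin_le_nhds
  have c1 : Continuous fun p : ℂ × (Fin (n + 1) → ℂ) × (Fin (n + 1) → ℂ) => p.1.re := by fun_prop
  have e1 : ∀ᶠ p in 𝓝[realContourDomain n] p₀, l' ≤ p.1.re :=
    (tendsto_nhdsWithin_iff.2 ⟨(c1.tendsto p₀).mono_left hle,
      eventually_mem_nhdsWithin.mono fun p hp => hp.1⟩ :
        Tendsto (fun p : ℂ × (Fin (n + 1) → ℂ) × (Fin (n + 1) → ℂ) => p.1.re)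
          (𝓝[realContourDomain n] p₀) (𝓝[Set.Ici 1] p₀.1.re)).eventually hev
  have e2 : ∀ᶠ p in 𝓝 p₀, p.1.re < p₀.1.re + 1 :=
    (c1.tendsto p₀).eventually_lt_const (lt_add_one _)
  have e3 : ∀ᶠ p in 𝓝 p₀, ∀ j, |(p.2.1 j).im| < μ := by
    rw [eventually_all]
    intro j
    have : Continuous fun p : ℂ × (Fin (n + 1) → ℂ) × (Fin (n + 1) → ℂ) => |(p.2.1 j).im| := by
      fun_prop
    exact (this.tendsto p₀).eventually_lt_const (hμ j)
  have e4 : ∀ᶠ p in 𝓝 p₀, ∀ j, |(p.2.1 j).re - z j| < M := by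
    rw [eventually_all]
    intro j
    have : Continuous fun p : ℂ × (Fin (n + 1) → ℂ) × (Fin (n + 1) → ℂ) =>
      |(p.2.1 j).re - z j| := by fun_prop
    refine (this.tendsto p₀).eventually_lt_const ?_
    exact (Finset.single_le_sum (f := fun j => |(p₀.2.1 j).re - z j|)
      (fun _ _ => abs_nonneg _) (Finset.mem_univ j)).trans_lt (lt_add_one _)
  have e5 : ∀ᶠ p in 𝓝 p₀, ∀ j, |(p.2.2 j).im - (p₀.2.2 j).im| < η := by
    rw [eventually_all]
    intro j
    have : Continuous fun p : ℂ × (Fin (n + 1) → ℂ) × (Fin (n + 1) → ℂ) =>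
      |(p.2.2 j).im - (p₀.2.2 j).im| := by fun_prop
    exact (this.tendsto p₀).eventually_lt_const (by simpa using hη)
  have e6 : ∀ᶠ p in 𝓝 p₀, kernelFactor n p.1 μ < C := by
    have : Continuous fun p : ℂ × (Fin (n + 1) → ℂ) × (Fin (n + 1) → ℂ) =>
        kernelFactor n p.1 μ := by
      unfold kernelFactor
      refine Continuous.pow (Continuous.mul (by fun_prop) ?_) _
      exact Continuous.rpow continuous_const (by fun_prop) fun _ => Or.inl hcos.ne'
    exact (this.tendsto p₀).eventually_lt_const (lt_add_one _)
  have hall := e1.and ((Filter.Eventually.and e2 (e3.and (e4.and (e5.and e6)))).filter_mono hle)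
  refine ⟨_, hall,
    fun s => (B s).toReal, integrable_toReal_of_lintegral_ne_top hBm.aemeasurable hBi, ?_⟩
  filter_upwards [ae_lt_top hBm hBi] with s hs
  rintro p ⟨h1, h2, h3, h4, h5, h6⟩
  rw [← toReal_enorm]
  refine ENNReal.toReal_mono hs.ne ?_
  have hkf : 0 ≤ kernelFactor n p.1 μ := by unfold kernelFactor; positivity
  have hC : 0 ≤ C := hkf.trans h6.le
  calc _ ≤ _ := enorm_stepIntegrand_le (zero_lt_one.trans_le (hl'1.trans h1))
        (fun j => (h3 j).le) hμ' p.2.2 s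
    _ ≤ ENNReal.ofReal C * (ENNReal.ofReal (K ^ (p₀.1.re + 1)) *
        (ENNReal.ofReal (|sinhProd s| ^ (2 * l') / coshProd z s ^ l') *
          majorant n l' s (dropLast fun j => (p.2.2 j).im))) := by
        refine mul_le_mul' (ENNReal.ofReal_le_ofReal h6.le) ((hKb p.1.re l' (by linarith) h1 _
          (fun j => (h4 j).le) s _).trans (mul_le_mul_left (ENNReal.ofReal_le_ofReal ?_) _))
        exact Real.rpow_le_rpow_of_exponent_le hK h2.le
    _ ≤ ENNReal.ofReal C * (ENNReal.ofReal (K ^ (p₀.1.re + 1)) *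
        (ENNReal.ofReal (|sinhProd s| ^ (2 * l') / coshProd z s ^ l') *
          ∑ w ∈ V, majorant n l' s (dropLast w))) := by
        refine mul_le_mul_right (mul_le_mul_right (mul_le_mul_right
          (majorant_le_sum_of_mem_convexHull (hVhull _ fun j => (h5 j).le) l' s) _) _) _
    _ = B s := by
        simp only [hB]
        rw [ENNReal.ofReal_mul hC, ← Finset.mul_sum, mul_assoc]

/-! ### Continuity and holomorphy of integrals with parameters. -/

theorem aestronglyMeasurable_clm {E α : Type*} [NormedAddCommGroup E] [NormedSpace ℂ E]
    [FiniteDimensional ℂ E] [MeasurableSpace α] {μ : Measure α} {L : α → E →L[ℂ] ℂ}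
    (h : ∀ v, AEStronglyMeasurable (fun s => L s v) μ) : AEStronglyMeasurable L μ := by
  set b := Module.finBasis ℂ E
  have e : L = fun s => ∑ i, L s (b i) • LinearMap.toContinuousLinearMap (b.coord i) := by
    ext s v
    have := congrArg (L s) (b.sum_repr v)
    rw [map_sum] at this
    rw [← this]
    simp [mul_comm]
  rw [e]
  exact Finset.aestronglyMeasurable_fun_sum _ fun i _ => (h (b i)).smul_const _

/-- An integral depending holomorphically on a parameter, with an integrable bound, is holomorphic.
-/
theorem differentiableAt_integral_of_dominated {E α : Type*} [NormedAddCommGroup E]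
    [NormedSpace ℂ E] [FiniteDimensional ℂ E] [MeasurableSpace α] {μ : Measure α}
    {f : E → α → ℂ} {U : Set E} {p₀ : E} (hU : U ∈ 𝓝 p₀)
    (hmeas : ∀ p ∈ U, AEStronglyMeasurable (f p) μ)
    (hd : ∀ s, DifferentiableOn ℂ (fun p => f p s) U) {bound : α → ℝ}
    (hb : Integrable bound μ) (hle : ∀ᵐ s ∂μ, ∀ p ∈ U, ‖f p s‖ ≤ bound s) :
    DifferentiableAt ℂ (fun p => ∫ s, f p s ∂μ) p₀ := by
  obtain ⟨r, hr, hrU⟩ := Metric.mem_nhds_iff.1 hU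
  have hr2 : 0 < r / 2 := half_pos hr
  have hsub : ∀ p ∈ Metric.ball p₀ (r / 2), Metric.ball p (r / 2) ⊆ U := fun p hp q hq =>
    hrU (by
      rw [Metric.mem_ball] at *
      linarith [dist_triangle q p p₀])
  have hdiff : ∀ s, ∀ p ∈ Metric.ball p₀ (r / 2),
      HasFDerivAt (fun p => f p s) (fderiv ℂ (fun p => f p s) p) p := fun s p hp =>
    ((hd s).differentiableAt (mem_of_superset (Metric.ball_mem_nhds p hr2)
      (hsub p hp))).hasFDerivAt
  have hp₀ : p₀ ∈ Metric.ball p₀ (r / 2) := Metric.mem_ball_self hr2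
  refine (hasFDerivAt_integral_of_dominated_of_fderiv_le
    (F' := fun p s => fderiv ℂ (fun p => f p s) p) (bound := fun s => 2 * bound s / (r / 2))
    (Metric.ball_mem_nhds p₀ hr2) (eventually_of_mem hU hmeas)
    (hb.mono' (hmeas p₀ (mem_of_mem_nhds hU)) (hle.mono fun s h => h p₀ (mem_of_mem_nhds hU)))
    ?_ ?_ ((hb.const_mul 2).div_const _) (.of_forall hdiff)).differentiableAt
  · refine aestronglyMeasurable_clm fun v => ?_
    -- The derivative in direction v is a limit of difference quotients with steps v/k, hence
    -- measurable. The index is shifted by N to keep the points inside U.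
    have hc : Tendsto (fun k : ℕ => p₀ + ((k : ℂ))⁻¹ • v) atTop (𝓝 p₀) := by
      have := (tendsto_inv_atTop_nhds_zero_nat (𝕜 := ℂ)).smul_const v
      simpa using this.const_add p₀
    obtain ⟨N, hN⟩ := eventually_atTop.1 (hc.eventually hU)
    refine aestronglyMeasurable_of_tendsto_ae atTop (f := fun (k : ℕ) s =>
      ((k + N : ℕ) : ℂ) • (f (p₀ + (((k + N : ℕ) : ℂ))⁻¹ • v) s - f p₀ s)) (fun k => ?_)
      (.of_forall fun s => ?_)
    · have h : AEStronglyMeasurable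
          (fun s => f (p₀ + (((k + N : ℕ) : ℂ))⁻¹ • v) s - f p₀ s) μ :=
        (hmeas _ (hN _ (Nat.le_add_left _ _))).sub (hmeas _ (mem_of_mem_nhds hU))
      exact h.const_smul ((k + N : ℕ) : ℂ)
    · refine (hdiff s p₀ hp₀).lim v ?_
      simp_rw [Complex.norm_natCast]
      exact tendsto_natCast_atTop_atTop.comp (tendsto_add_atTop_nat N)
  -- Cauchy's estimate on a ball of radius r/2: the bound on f already dominates the derivative.
  · filter_upwards [hle] with s hs p hp
    refine Complex.norm_fderiv_le_div_of_mapsTo_ball ((hd s).mono (hsub p hp)) (fun q hq => ?_) hr2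
    rw [mem_closedBall_iff_norm]
    have h1 := hs q (hsub p hp hq)
    have h2 := hs p (hsub p hp (Metric.mem_ball_self hr2))
    linarith [norm_sub_le (f q s) (f p s)]

theorem abs_im_sub_lt_pi {n : ℕ} {t : Fin n → ℂ} (ht : t ∈ reducedDomain n) (j k : Fin n) :
    |(t j - t k).im| < Real.pi := by
  have h : ∀ j, |(relative t j).im| < Real.pi / 2 := fun j =>
    (le_ciSup (Set.finite_range fun j => |(relative t j).im|).bddAbove j).trans_lt ht
  have e : (t j - t k).im = (relative t j).im - (relative t k).im := by simp [relative]
  rw [e]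
  linarith [abs_sub (relative t j).im (relative t k).im, h j, h k]

theorem abs_relative_im_le {n : ℕ} (t : Fin n → ℂ) (j : Fin n) :
    |(relative t j).im| ≤ maxIm t :=
  le_ciSup (Set.finite_range fun j => |(relative t j).im|).bddAbove j

/-- The imaginary parts spread over less than π, so the midpoint of their range is within π/2 of
each of them. -/
theorem abs_im_sub_midHeight_lt {n : ℕ} {t : Fin (n + 1) → ℂ}
    (ht : ∀ j k, |(t j - t k).im| < Real.pi) (j : Fin (n + 1)) :
    |(t j).im - midHeight t| < Real.pi / 2 := by
  obtain ⟨a, ha⟩ := exists_eq_ciSup_of_finite (f := fun j => (t j).im)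
  obtain ⟨b, hb⟩ := exists_eq_ciInf_of_finite (f := fun j => (t j).im)
  have h1 := le_ciSup (Set.finite_range fun j => (t j).im).bddAbove j
  have h2 := ciInf_le (Set.finite_range fun j => (t j).im).bddBelow j
  rw [midHeight, ← ha, ← hb]
  rw [← ha] at h1
  rw [← hb] at h2
  have h3 := (abs_lt.1 (ht a b)).2
  rw [Complex.sub_im] at h3
  rw [abs_lt]
  constructor <;> linarith

theorem relative_ofRealVec_im {n : ℕ} (s : Fin n → ℝ) (j : Fin n) :
    (relative (ofRealVec s) j).im = 0 := by
  have : relative (ofRealVec s) j = ((s j - (∑ k, s k) / n : ℝ) : ℂ) := by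
    simp [relative, mean, ofRealVec]
  rw [this, Complex.ofReal_im]

theorem ofRealVec_mem_reducedDomain {n : ℕ} (s : Fin n → ℝ) :
    ofRealVec s ∈ reducedDomain n := by
  have : maxIm (ofRealVec s) = 0 := by simp [maxIm, relative_ofRealVec_im]
  rw [reducedDomain, Set.mem_ofPred_eq, this]
  positivity

theorem ofRealVec_mem_extDomain {n : ℕ} {p : ℂ × (Fin (n + 1) → ℂ) × (Fin (n + 1) → ℂ)}
    (hp : p ∈ realContourDomain n) (s : Fin n → ℝ) :
    (p.1, ofRealVec s, dropLast p.2.2) ∈ extDomain n :=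
  ⟨hp.1, ofRealVec_mem_reducedDomain s, fun j k => by
    simpa [dropLast] using hp.2.2 j.castSucc k.castSucc⟩

/-- The part of `realContourDomain` where the real part of the coupling exceeds one. -/
def openContourDomain (n : ℕ) : Set (ℂ × (Fin (n + 1) → ℂ) × (Fin (n + 1) → ℂ)) :=
  {p | 1 < p.1.re ∧ (∀ j, |(p.2.1 j).im| < Real.pi / 2) ∧
    ∀ j k, |(p.2.2 j - p.2.2 k).im| < 2 * p.1.re}

theorem openContourDomain_subset (n : ℕ) : openContourDomain n ⊆ realContourDomain n :=
  fun _ hp => ⟨hp.1.le, hp.2⟩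

theorem isOpen_openContourDomain (n : ℕ) : IsOpen (openContourDomain n) := by
  have c1 : Continuous fun p : ℂ × (Fin (n + 1) → ℂ) × (Fin (n + 1) → ℂ) => p.1.re := by fun_prop
  have h1 : IsOpen {p : ℂ × (Fin (n + 1) → ℂ) × (Fin (n + 1) → ℂ) |
      ∀ j, |(p.2.1 j).im| < Real.pi / 2} := by
    simp only [Set.ofPred_forall]
    exact isOpen_iInter_of_finite fun j => isOpen_lt (by fun_prop) continuous_const
  have h2 : IsOpen {p : ℂ × (Fin (n + 1) → ℂ) × (Fin (n + 1) → ℂ) |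
      ∀ j k, |(p.2.2 j - p.2.2 k).im| < 2 * p.1.re} := by
    simp only [Set.ofPred_forall]
    exact isOpen_iInter_of_finite fun j => isOpen_iInter_of_finite fun k =>
      isOpen_lt (by fun_prop) (by fun_prop)
  exact (isOpen_lt continuous_const c1).inter (h1.inter h2)

theorem mem_slitPlane_two_mul_cosh {z : ℂ} (hz : |z.im| < Real.pi / 2) :
    2 * Complex.cosh z ∈ Complex.slitPlane := by
  left
  have h := abs_lt.1 hz
  have := mul_pos (Real.cosh_pos z.re) (Real.cos_pos_of_mem_Ioo ⟨h.1, h.2⟩)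
  rw [← re_cosh] at this
  simpa using this

theorem differentiableAt_prod {ι E : Type*} [NormedAddCommGroup E] [NormedSpace ℂ E]
    (S : Finset ι) {f : ι → E → ℂ} {x : E} (h : ∀ i ∈ S, DifferentiableAt ℂ (f i) x) :
    DifferentiableAt ℂ (fun y => ∏ i ∈ S, f i y) x := by
  classical
  induction S using Finset.induction_on with
  | empty => simp
  | insert a S ha ih =>
    simp_rw [Finset.prod_insert ha]
    exact (h a (Finset.mem_insert_self _ _)).mul
      (ih fun i hi => h i (Finset.mem_insert_of_mem hi))

theorem differentiableAt_kernel {n : ℕ} (s : Fin n → ℝ) {q : ℂ × (Fin (n + 1) → ℂ)}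
    (hq : ∀ j, |(q.2 j).im| < Real.pi / 2) :
    DifferentiableAt ℂ (fun q : ℂ × (Fin (n + 1) → ℂ) => kernel q.1 q.2 (ofRealVec s)) q := by
  unfold kernel
  refine differentiableAt_prod _ fun j _ => differentiableAt_prod _ fun k _ => ?_
  refine DifferentiableAt.cpow (by fun_prop) (by fun_prop) (mem_slitPlane_two_mul_cosh ?_)
  simpa [ofRealVec] using hq j

/-- The base vanishes where entries of s coincide, and 0^λ is locally constant in λ only away from λ
= 0. -/
theorem differentiableAt_weight {n : ℕ} (s : Fin n → ℝ) {lam : ℂ} (hl : lam ≠ 0) :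
    DifferentiableAt ℂ (fun lam => weight lam (ofRealVec s)) lam := by
  unfold weight
  refine differentiableAt_prod _ fun j _ => differentiableAt_prod _ fun k _ => ?_
  exact differentiableAt_fun_id.const_cpow (Or.inr hl)

/-- Only the kernel depends on z; the inner F is a constant factor. Hence this needs no holomorphy
of F and covers Re λ = 1. -/
theorem differentiableAt_stepIntegrand_sub {n : ℕ} (lam : ℂ) {t : Fin (n + 1) → ℂ}
    (u : Fin (n + 1) → ℂ) (s : Fin n → ℝ) {z : ℂ} (hz : ∀ j, |(t j - z).im| < Real.pi / 2) :
    DifferentiableAt ℂ (fun z => stepIntegrand (F n lam) lam (fun j => t j - z) u 0 s) z := by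
  have h2 : DifferentiableAt ℂ (fun w => kernel lam (fun j => t j - w) (ofRealVec s)) z := by
    unfold kernel
    refine differentiableAt_prod _ fun j _ => differentiableAt_prod _ fun k _ => ?_
    refine DifferentiableAt.cpow (by fun_prop) (by fun_prop) (mem_slitPlane_two_mul_cosh ?_)
    simpa [ofRealVec] using hz j
  refine ((h2.const_mul (weight lam (ofRealVec s))).mul_const
    (F n lam (ofRealVec s) (dropLast u))).congr_of_eventuallyEq (.of_forall fun w => ?_)
  exact stepIntegrand_zero _ _ _ _ _

theorem ne_zero_of_one_le_re {lam : ℂ} (h : 1 ≤ lam.re) : lam ≠ 0 := by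
  rintro rfl
  norm_num at h

theorem continuous_ofRealVec {n : ℕ} : Continuous (ofRealVec (n := n)) := by
  unfold ofRealVec; fun_prop

theorem differentiable_dropLast {n : ℕ} :
    Differentiable ℂ (dropLast : (Fin (n + 1) → ℂ) → Fin n → ℂ) := by
  unfold dropLast; fun_prop

/-- Joint continuity and holomorphy of `F`. -/
def Regular (n : ℕ) : Prop :=
  ContinuousOn (fun p : ℂ × (Fin n → ℂ) × (Fin n → ℂ) => F n p.1 p.2.1 p.2.2) (extDomain n) ∧
    DifferentiableOn ℂ (fun p : ℂ × (Fin n → ℂ) × (Fin n → ℂ) => F n p.1 p.2.1 p.2.2)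
      (holoDomain n)

/-- Measurability of the inner F in s comes from its continuity, one reason to carry continuity
through the induction. -/
theorem Regular.aestronglyMeasurable {n : ℕ} (h : Regular n)
    {p : ℂ × (Fin (n + 1) → ℂ) × (Fin (n + 1) → ℂ)} (hp : p ∈ realContourDomain n) :
    AEStronglyMeasurable fun s : Fin n → ℝ =>
      stepIntegrand (F n p.1) p.1 p.2.1 p.2.2 0 s := by
  simp_rw [stepIntegrand_zero]
  refine (AEStronglyMeasurable.mul ?_ ?_).mul ?_
  · refine Measurable.aestronglyMeasurable ?_
    unfold weight ofRealVec
    refine Finset.measurable_fun_prod _ fun j _ => Finset.measurable_fun_prod _ fun k _ => ?_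
    exact Measurable.pow_const (by fun_prop) _
  · refine Measurable.aestronglyMeasurable ?_
    unfold kernel ofRealVec
    refine Finset.measurable_fun_prod _ fun j _ => Finset.measurable_fun_prod _ fun k _ => ?_
    exact Measurable.pow_const (by fun_prop) _
  · refine Continuous.aestronglyMeasurable ?_
    exact h.1.comp_continuous (f := fun s : Fin n → ℝ => (p.1, ofRealVec s, dropLast p.2.2))
      (continuous_const.prodMk (continuous_ofRealVec.prodMk continuous_const))
      fun s => ofRealVec_mem_extDomain hp s

theorem Regular.continuousOn_stepIntegrand {n : ℕ} (h : Regular n) (s : Fin n → ℝ) :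
    ContinuousOn (fun p : ℂ × (Fin (n + 1) → ℂ) × (Fin (n + 1) → ℂ) =>
      stepIntegrand (F n p.1) p.1 p.2.1 p.2.2 0 s) (realContourDomain n) := by
  simp_rw [stepIntegrand_zero]
  refine (ContinuousOn.mul ?_ ?_).mul ?_
  · intro p hp
    exact ((differentiableAt_weight s (ne_zero_of_one_le_re hp.1)).continuousAt.comp
      (f := fun p : ℂ × (Fin (n + 1) → ℂ) × (Fin (n + 1) → ℂ) => p.1)
      continuousAt_fst).continuousWithinAt
  · intro p hp
    exact ((differentiableAt_kernel s (q := (p.1, p.2.1)) hp.2.1).continuousAt.comp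
      (f := fun p : ℂ × (Fin (n + 1) → ℂ) × (Fin (n + 1) → ℂ) => (p.1, p.2.1))
      (by fun_prop)).continuousWithinAt
  · refine h.1.comp (f := fun p : ℂ × (Fin (n + 1) → ℂ) × (Fin (n + 1) → ℂ) =>
      (p.1, ofRealVec s, dropLast p.2.2)) (Continuous.continuousOn ?_)
      fun p hp => ofRealVec_mem_extDomain hp s
    exact continuous_fst.prodMk (continuous_const.prodMk
      (differentiable_dropLast.continuous.comp (by fun_prop)))

theorem Regular.differentiableOn_stepIntegrand {n : ℕ} (h : Regular n) (s : Fin n → ℝ) :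
    DifferentiableOn ℂ (fun p : ℂ × (Fin (n + 1) → ℂ) × (Fin (n + 1) → ℂ) =>
      stepIntegrand (F n p.1) p.1 p.2.1 p.2.2 0 s) (openContourDomain n) := by
  simp_rw [stepIntegrand_zero]
  refine (DifferentiableOn.mul ?_ ?_).mul ?_
  · intro p hp
    exact ((differentiableAt_weight s (ne_zero_of_one_le_re hp.1.le)).comp p
      (f := fun p : ℂ × (Fin (n + 1) → ℂ) × (Fin (n + 1) → ℂ) => p.1)
      differentiableAt_fst).differentiableWithinAt
  · intro p hp
    exact ((differentiableAt_kernel s (q := (p.1, p.2.1)) hp.2.1).comp p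
      (f := fun p : ℂ × (Fin (n + 1) → ℂ) × (Fin (n + 1) → ℂ) => (p.1, p.2.1))
      (by fun_prop)).differentiableWithinAt
  · refine h.2.comp (f := fun p : ℂ × (Fin (n + 1) → ℂ) × (Fin (n + 1) → ℂ) =>
      (p.1, ofRealVec s, dropLast p.2.2)) (Differentiable.differentiableOn ?_)
      fun p hp => ⟨hp.1, (ofRealVec_mem_extDomain (openContourDomain_subset n hp) s).2⟩
    exact differentiable_fst.prodMk ((differentiable_const _).prodMk
      (differentiable_dropLast.comp (by fun_prop)))

/-- The integral over the real contour. -/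
def contourIntegral {n : ℕ} (lam : ℂ) (t u : Fin (n + 1) → ℂ) : ℂ :=
  ∫ s : Fin n → ℝ, stepIntegrand (F n lam) lam t u 0 s

theorem Regular.integrable_stepIntegrand {n : ℕ} (h : Regular n)
    {p : ℂ × (Fin (n + 1) → ℂ) × (Fin (n + 1) → ℂ)} (hp : p ∈ realContourDomain n) :
    Integrable fun s : Fin n → ℝ => stepIntegrand (F n p.1) p.1 p.2.1 p.2.2 0 s := by
  obtain ⟨Z, hZ, bound, hb, hle⟩ := exists_integrable_bound hp
  exact hb.mono' (h.aestronglyMeasurable hp) (hle.mono fun s hs => hs p (mem_of_mem_nhdsWithin hp hZ))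

theorem Regular.continuousOn_contourIntegral {n : ℕ} (h : Regular n) :
    ContinuousOn (fun p : ℂ × (Fin (n + 1) → ℂ) × (Fin (n + 1) → ℂ) =>
      contourIntegral p.1 p.2.1 p.2.2) (realContourDomain n) := by
  intro p hp
  obtain ⟨Z, hZ, bound, hb, hle⟩ := exists_integrable_bound hp
  refine continuousWithinAt_of_dominated (bound := bound)
    (eventually_mem_nhdsWithin.mono fun q hq => h.aestronglyMeasurable hq)
    (eventually_of_mem hZ fun q hq => hle.mono fun s hs => hs q hq) hb
    (.of_forall fun s => h.continuousOn_stepIntegrand s p hp)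

theorem Regular.differentiableOn_contourIntegral {n : ℕ} (h : Regular n) :
    DifferentiableOn ℂ (fun p : ℂ × (Fin (n + 1) → ℂ) × (Fin (n + 1) → ℂ) =>
      contourIntegral p.1 p.2.1 p.2.2) (openContourDomain n) := by
  intro p hp
  obtain ⟨Z, hZ, bound, hb, hle⟩ := exists_integrable_bound (openContourDomain_subset n hp)
  have hO := (isOpen_openContourDomain n).mem_nhds hp
  have hZ' : Z ∈ 𝓝 p := by
    have := nhdsWithin_mono p (openContourDomain_subset n) hZ
    rwa [(isOpen_openContourDomain n).nhdsWithin_eq hp] at this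
  exact (differentiableAt_integral_of_dominated (inter_mem hO hZ')
    (fun q hq => h.aestronglyMeasurable (openContourDomain_subset n hq.1))
    (fun s => (h.differentiableOn_stepIntegrand s).mono Set.inter_subset_left) hb
    (hle.mono fun s hs q hq => hs q hq.2)).differentiableWithinAt

/-! ### The contour shift. -/

/-- The contour integral after a translation of `t`, normalized so as not to depend on real
translations. -/
def shiftedIntegral {n : ℕ} (lam : ℂ) (t u : Fin (n + 1) → ℂ) (z : ℂ) : ℂ :=
  Complex.exp (Complex.I * z * ∑ j, dropLast u j) * contourIntegral lam (fun j => t j - z) u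

theorem contourIntegral_add_ofReal {n : ℕ} (lam : ℂ) (t u : Fin (n + 1) → ℂ) (r : ℝ) :
    contourIntegral lam (fun j => t j + r) u =
      Complex.exp (Complex.I * r * ∑ j, dropLast u j) * contourIntegral lam t u := by
  rw [contourIntegral, ← integral_add_right_eq_self _ (fun _ : Fin n => r), contourIntegral,
    ← integral_const_mul]
  refine integral_congr_ae (.of_forall fun s => ?_)
  have := stepIntegrand_add_const (fun s u c => F_add_const lam s u c) lam t u 0 (r : ℂ) s
  simp only [Complex.ofReal_im, Complex.ofReal_re, add_zero] at this
  exact this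

theorem shiftedIntegral_add_ofReal {n : ℕ} (lam : ℂ) (t u : Fin (n + 1) → ℂ) (z : ℂ) (r : ℝ) :
    shiftedIntegral lam t u (z + r) = shiftedIntegral lam t u z := by
  have h := contourIntegral_add_ofReal lam (fun j => t j - (z + r)) u r
  simp only [sub_add_eq_sub_sub, sub_add_cancel] at h
  rw [shiftedIntegral, shiftedIntegral, h, ← mul_assoc, ← Complex.exp_add]
  simp only [sub_add_eq_sub_sub]
  congr 2
  ring

/-- Contour shift. -/
theorem Regular.shiftedIntegral_eq {n : ℕ} (h : Regular n) {lam : ℂ} {t u : Fin (n + 1) → ℂ}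
    (hl : 1 ≤ lam.re) (hu : ∀ j k, |(u j - u k).im| < 2 * lam.re) {z w : ℂ}
    (hz : ∀ j, |(t j - z).im| < Real.pi / 2) (hw : ∀ j, |(t j - w).im| < Real.pi / 2) :
    shiftedIntegral lam t u z = shiftedIntegral lam t u w := by
  set S : Set ℂ := {z | ∀ j, |(t j - z).im| < Real.pi / 2} with hS
  have hSopen : IsOpen S := by
    simp only [hS, Set.ofPred_forall]
    exact isOpen_iInter_of_finite fun j => isOpen_lt (by fun_prop) continuous_const
  have hSconv : Convex ℝ S := by
    have : S = ⋂ j, Complex.im ⁻¹' Set.Ioo ((t j).im - Real.pi / 2) ((t j).im + Real.pi / 2) := by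
      ext z
      simp only [hS, Set.mem_ofPred_eq, Set.mem_iInter, Set.mem_preimage, Set.mem_Ioo, abs_lt,
        Complex.sub_im]
      exact forall_congr' fun j => ⟨fun h => ⟨by linarith [h.2], by linarith [h.1]⟩,
        fun h => ⟨by linarith [h.2], by linarith [h.1]⟩⟩
    rw [this]
    exact convex_iInter fun j => (convex_Ioo _ _).linear_preimage Complex.imLm
  have hmem : ∀ z ∈ S, (lam, (fun j => t j - z), u) ∈ realContourDomain n := fun z hz =>
    ⟨hl, hz, hu⟩
  have hdiff : DifferentiableOn ℂ (shiftedIntegral lam t u) S := by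
    intro z hz
    obtain ⟨Z, hZ, bound, hb, hle⟩ := exists_integrable_bound (hmem z hz)
    have hcont : Continuous fun z : ℂ => ((lam, (fun j => t j - z), u) :
        ℂ × (Fin (n + 1) → ℂ) × (Fin (n + 1) → ℂ)) := by fun_prop
    have hSz : S ∈ 𝓝 z := hSopen.mem_nhds hz
    have hpre : (fun z : ℂ => ((lam, (fun j => t j - z), u) :
        ℂ × (Fin (n + 1) → ℂ) × (Fin (n + 1) → ℂ))) ⁻¹' Z ∈ 𝓝 z :=
      (tendsto_nhdsWithin_iff.2 ⟨hcont.tendsto z, eventually_of_mem hSz hmem⟩) hZ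
    have hR : DifferentiableAt ℂ (fun z => contourIntegral lam (fun j => t j - z) u) z :=
      differentiableAt_integral_of_dominated
        (f := fun z s => stepIntegrand (F n lam) lam (fun j => t j - z) u 0 s) (inter_mem hSz hpre)
        (fun w hw => h.aestronglyMeasurable (p := (lam, fun j => t j - w, u)) (hmem w hw.1))
        (fun s w hw =>
          (differentiableAt_stepIntegrand_sub lam u s hw.1).differentiableWithinAt) hb
        (hle.mono fun s hs w hw => hs (lam, fun j => t j - w, u) hw.2)
    exact (DifferentiableAt.mul (by fun_prop) hR).differentiableWithinAt
  -- Invariance under real shifts makes the derivative along the real direction vanish. By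
  -- holomorphy this is the complex derivative, and the strip is connected. No rectangle contour or
  -- decay at infinity is needed.
  refine hSopen.is_const_of_deriv_eq_zero hSconv.isPreconnected hdiff (fun z hz => ?_) hz hw
  have hd := (hdiff.differentiableAt (hSopen.mem_nhds hz)).hasDerivAt
  have h1 : HasDerivAt (fun r : ℝ => shiftedIntegral lam t u (z + r))
      (deriv (shiftedIntegral lam t u) z) 0 := by
    have h2 : HasDerivAt (fun r : ℂ => z + r) 1 ((0 : ℝ) : ℂ) := (hasDerivAt_id _).const_add z
    have h3 : HasDerivAt (shiftedIntegral lam t u) (deriv (shiftedIntegral lam t u) z)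
        (z + ((0 : ℝ) : ℂ)) := by simpa using hd
    simpa using (h3.comp _ h2).comp_ofReal
  simp_rw [shiftedIntegral_add_ofReal] at h1
  exact h1.unique (hasDerivAt_const _ _)

/-! ### Separating the centre of mass, and the induction for regularity. -/

theorem sum_relative {n : ℕ} (t : Fin (n + 1) → ℂ) : ∑ j, relative t j = 0 := by
  have : ((n : ℂ) + 1) ≠ 0 := by exact_mod_cast n.succ_ne_zero
  simp only [relative, mean, Finset.sum_sub_distrib, Finset.sum_const, Finset.card_univ,
    Fintype.card_fin, nsmul_eq_mul]
  push_cast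
  field_simp
  ring

theorem natCast_mul_mean {n : ℕ} (t : Fin (n + 1) → ℂ) : ((n + 1 : ℕ) : ℂ) * mean t = ∑ j, t j := by
  have : ((n : ℂ) + 1) ≠ 0 := by exact_mod_cast n.succ_ne_zero
  simp only [mean]
  push_cast
  field_simp

theorem relative_mem_realContourDomain {n : ℕ}
    {p : ℂ × (Fin (n + 1) → ℂ) × (Fin (n + 1) → ℂ)} (hp : p ∈ extDomain (n + 1)) :
    (p.1, relative p.2.1, p.2.2) ∈ realContourDomain n :=
  ⟨hp.1, fun j => (abs_relative_im_le p.2.1 j).trans_lt hp.2.1, hp.2.2⟩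

theorem Regular.integrable_midHeight {n : ℕ} (h : Regular n) {lam : ℂ} {t u : Fin (n + 1) → ℂ}
    (hp : (lam, t, u) ∈ extDomain (n + 1)) :
    Integrable fun s : Fin n → ℝ => stepIntegrand (F n lam) lam t u (midHeight t) s := by
  simp_rw [stepIntegrand_eq_stepIntegrand_zero lam t u (midHeight t)]
  refine Integrable.const_mul ?_ _
  refine h.integrable_stepIntegrand (p := (lam, fun j => t j - Complex.I * midHeight t, u))
    ⟨hp.1, fun j => ?_, hp.2.2⟩
  simpa using abs_im_sub_midHeight_lt (abs_im_sub_lt_pi hp.2.1) j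

/-- The defining integral of `F` may be taken over the real contour when the imaginary parts of `t`
are small. -/
theorem Regular.integral_midHeight_eq {n : ℕ} (h : Regular n) {lam : ℂ} {t u : Fin (n + 1) → ℂ}
    (hp : (lam, t, u) ∈ realContourDomain n) :
    ∫ s : Fin n → ℝ, stepIntegrand (F n lam) lam t u (midHeight t) s =
      contourIntegral lam t u := by
  simp_rw [stepIntegrand_eq_stepIntegrand_zero lam t u (midHeight t)]
  rw [integral_const_mul]
  have ht : ∀ j k, |(t j - t k).im| < Real.pi := fun j k => by
    rw [Complex.sub_im]
    linarith [abs_sub (t j).im (t k).im, hp.2.1 j, hp.2.1 k]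
  have := h.shiftedIntegral_eq (t := t) (u := u) (z := Complex.I * midHeight t) (w := 0) hp.1
    hp.2.2 (fun j => by simpa using abs_im_sub_midHeight_lt ht j)
    (fun j => by simpa using hp.2.1 j)
  simpa [shiftedIntegral, contourIntegral] using this

/-- Translating t by its mean produces the plane wave. The entries of `relative t` sum to zero, so
no other prefactor remains, and their imaginary parts lie below π/2, so the contour can be moved to
the real one. -/
theorem Regular.F_succ_eq {n : ℕ} (h : Regular n) {lam : ℂ} {t u : Fin (n + 1) → ℂ}
    (hp : (lam, t, u) ∈ extDomain (n + 1)) :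
    F (n + 1) lam t u =
      Complex.exp (Complex.I * ((n + 1 : ℕ) : ℂ) * mean t * mean u) * reducedF lam t u := by
  have e : t = fun j => relative t j + mean t := by ext j; simp [relative]
  conv_lhs => rw [e]
  rw [F_add_const, ← natCast_mul_mean u, F, sum_relative,
    h.integral_midHeight_eq (relative_mem_realContourDomain hp), reducedF, contourIntegral]
  simp only [mul_zero, Complex.exp_zero]
  congr 2
  ring

theorem differentiable_mean {n : ℕ} : Differentiable ℂ (mean : (Fin n → ℂ) → ℂ) := by
  unfold mean; fun_prop

theorem differentiable_relative {n : ℕ} :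
    Differentiable ℂ (relative : (Fin n → ℂ) → Fin n → ℂ) := by
  unfold relative mean; fun_prop

theorem holoDomain_subset_extDomain (n : ℕ) : holoDomain n ⊆ extDomain n :=
  fun _ hp => ⟨hp.1.le, hp.2⟩

theorem regular (n : ℕ) : Regular n := by
  induction n with
  | zero => exact ⟨continuousOn_const, differentiableOn_const _⟩
  | succ n ih =>
    set e : ℂ × (Fin (n + 1) → ℂ) × (Fin (n + 1) → ℂ) → ℂ := fun p =>
      Complex.exp (Complex.I * ((n + 1 : ℕ) : ℂ) * mean p.2.1 * mean p.2.2) *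
        (1 / (n.factorial : ℂ)) with he
    set φ : ℂ × (Fin (n + 1) → ℂ) × (Fin (n + 1) → ℂ) →
        ℂ × (Fin (n + 1) → ℂ) × (Fin (n + 1) → ℂ) := fun p => (p.1, relative p.2.1, p.2.2)
    have hφ : Differentiable ℂ φ :=
      differentiable_fst.prodMk ((differentiable_relative.comp (by fun_prop)).prodMk (by fun_prop))
    have hed : Differentiable ℂ e := by
      have h1 : Differentiable ℂ fun p : ℂ × (Fin (n + 1) → ℂ) × (Fin (n + 1) → ℂ) =>
        mean p.2.1 := differentiable_mean.comp (by fun_prop)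
      have h2 : Differentiable ℂ fun p : ℂ × (Fin (n + 1) → ℂ) × (Fin (n + 1) → ℂ) =>
        mean p.2.2 := differentiable_mean.comp (by fun_prop)
      exact (((h1.const_mul _).mul h2).cexp).mul_const _
    -- The contour height `midHeight t` is not holomorphic in t. This formula replaces it by the
    -- fixed real contour.
    have hF : ∀ p ∈ extDomain (n + 1), F (n + 1) p.1 p.2.1 p.2.2 =
        e p * contourIntegral (φ p).1 (φ p).2.1 (φ p).2.2 := by
      intro p hp
      rw [ih.F_succ_eq hp, reducedF, ← mul_assoc]
      rfl
    refine ⟨ContinuousOn.congr ?_ hF, DifferentiableOn.congr ?_ fun p hp =>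
      hF p (holoDomain_subset_extDomain _ hp)⟩
    · exact hed.continuous.continuousOn.mul (ih.continuousOn_contourIntegral.comp
        hφ.continuous.continuousOn fun p hp => relative_mem_realContourDomain hp)
    · exact hed.differentiableOn.mul (ih.differentiableOn_contourIntegral.comp
        hφ.differentiableOn fun p hp =>
          ⟨hp.1, (relative_mem_realContourDomain (holoDomain_subset_extDomain _ hp)).2⟩)

/-! ### The explicit bound on F. -/

theorem kernelFactor_nonneg (n : ℕ) (lam : ℂ) {μ : ℝ} (hμ : μ ∈ Set.Ico 0 (Real.pi / 2)) :
    0 ≤ kernelFactor n lam μ := by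
  have := Real.cos_nonneg_of_neg_pi_div_two_le_of_le (x := μ)
    (by linarith [hμ.1, Real.pi_pos]) hμ.2.le
  unfold kernelFactor
  positivity

theorem continuousOn_kernelFactor (n : ℕ) :
    ContinuousOn (fun q : ℂ × ℝ => kernelFactor n q.1 q.2)
      ({lam : ℂ | 1 ≤ lam.re} ×ˢ Set.Ico 0 (Real.pi / 2)) := by
  unfold kernelFactor
  refine ContinuousOn.pow (ContinuousOn.mul (Continuous.continuousOn (by fun_prop)) ?_) _
  refine ContinuousOn.rpow (Continuous.continuousOn (by fun_prop))
    (Continuous.continuousOn (by fun_prop)) fun q hq => Or.inl ?_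
  exact (Real.cos_pos_of_mem_Ioo ⟨by linarith [hq.2.1, Real.pi_pos], hq.2.2⟩).ne'

theorem norm_reducedF_le {n : ℕ} {lam : ℂ} {t u : Fin (n + 1) → ℂ} (hl : 0 < lam.re)
    (ht : t ∈ reducedDomain (n + 1)) :
    ‖reducedF lam t u‖ₑ ≤ ENNReal.ofReal (kernelFactor n lam (maxIm t)) *
      majorant (n + 1) lam.re (fun j => (relative t j).re) (fun j => (u j).im) := by
  have hsum : ∑ j, (relative t j).re = 0 := by
    rw [← Complex.re_sum, sum_relative, Complex.zero_re]
  rw [reducedF, enorm_mul, majorant, hsum]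
  simp only [mul_zero, neg_zero, Real.exp_zero, ENNReal.ofReal_one, one_mul]
  have h1 : ‖(1 / (n.factorial : ℂ))‖ₑ ≤ 1 := by
    rw [← ofReal_norm, ENNReal.ofReal_le_one, norm_div, norm_one, Complex.norm_natCast]
    exact div_le_one_of_le₀ (by exact_mod_cast Nat.one_le_iff_ne_zero.2 n.factorial_ne_zero)
      (Nat.cast_nonneg _)
  refine (mul_le_of_le_one_left' h1).trans ((enorm_integral_le_lintegral_enorm _).trans ?_)
  rw [← lintegral_const_mul' _ _ ENNReal.ofReal_ne_top]
  exact lintegral_mono fun s => enorm_stepIntegrand_le hl (abs_relative_im_le t) ht u s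

/-- The two scalings cancel in each product. The mean of u drops out because the entries of
`relative t` sum to zero. -/
theorem altSum_eq_det {n : ℕ} {lam : ℂ} (hl : lam.re ≠ 0) (t u : Fin (n + 1) → ℂ) :
    altSum t u = (expMatrix (lam.re • fun j => (relative t j).re)
      (lam.re⁻¹ • fun j => (u j).im)).det := by
  rw [Matrix.det_apply', altSum]
  refine Finset.sum_congr rfl fun τ _ => ?_
  congr 1
  simp only [expMatrix, Matrix.of_apply, Pi.smul_apply, smul_eq_mul]
  rw [← Real.exp_sum, Finset.sum_neg_distrib]
  congr 2
  have hsum : ∑ j, (relative t (τ j)).re = 0 := by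
    rw [Equiv.sum_comp τ fun j => (relative t j).re, ← Complex.re_sum, sum_relative,
      Complex.zero_re]
  have e : ∀ j, (relative t (τ j)).re * (relative u j).im =
      (relative t (τ j)).re * (u j).im - (relative t (τ j)).re * (mean u).im := fun j => by
    rw [← mul_sub, relative, relative, Complex.sub_im]
  simp_rw [e]
  rw [Finset.sum_sub_distrib, ← Finset.sum_mul, hsum, zero_mul, sub_zero]
  refine Finset.sum_congr rfl fun j _ => ?_
  field_simp

/-- At generic points the rescaled majorant is comparable to `altSum t u / boundDenom lam t u`. -/
theorem exists_majorant_le_altSum_div (n : ℕ) :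
    ∃ c : ℝ, 0 < c ∧ ∀ (lam : ℂ) (t u : Fin (n + 1) → ℂ), 1 ≤ lam.re →
      (∀ j k, j < k → (t j - t k).re ≠ 0) →
      (∀ j k, j < k → |(u j - u k).im| ∈ Set.Ioo 0 (2 * lam.re)) →
      0 < altSum t u / boundDenom lam t u ∧
      majorant (n + 1) lam.re (fun j => (relative t j).re) (fun j => (u j).im) ≤
        ENNReal.ofReal (c * (altSum t u / boundDenom lam t u)) := by
  obtain ⟨a, ha, hscale⟩ := exists_majorant_le_majorant_one (n + 1)
  obtain ⟨b, hb, hexact⟩ := exists_majorant_one_eq (n + 1)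
  set p : ℝ := ∏ j : Fin (n + 1), ∏ k ∈ Finset.Ioi j, 2
  set q : ℝ := ∏ j : Fin (n + 1), ∏ k ∈ Finset.Ioi j, 2 * Real.pi
  have hp : 0 < p := by positivity
  have hq : 0 < q := Finset.prod_pos fun _ _ => Finset.prod_pos fun _ _ => by positivity
  refine ⟨a * (b / p * q), by positivity, fun lam t u hl ht hu => ?_⟩
  have hl0 : 0 < lam.re := zero_lt_one.trans_le hl
  set y : Fin (n + 1) → ℝ := lam.re • fun j => (relative t j).re with hy
  set w : Fin (n + 1) → ℝ := lam.re⁻¹ • fun j => (u j).im with hw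
  have hyd : ∀ j k, y j - y k = lam.re * (t j - t k).re := fun j k => by
    simp [hy, relative, mul_sub]
  have hwd : ∀ j k, w j - w k = (u j - u k).im / lam.re := fun j k => by
    simp [hw, mul_sub, div_eq_inv_mul]
  have hyinj : Function.Injective y := by
    intro j k hjk
    by_contra hne
    rcases lt_or_gt_of_ne hne with h | h
    · have := hyd j k
      rw [hjk, sub_self, eq_comm, mul_eq_zero] at this
      exact this.elim hl0.ne' (ht j k h)
    · have := hyd k j
      rw [hjk, sub_self, eq_comm, mul_eq_zero] at this
      exact this.elim hl0.ne' (ht k j h)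
  have hu' : ∀ j k, j ≠ k → |(u j - u k).im| ∈ Set.Ioo 0 (2 * lam.re) := fun j k hne => by
    rcases lt_or_gt_of_ne hne with h | h
    · exact hu j k h
    · rw [← neg_sub, Complex.neg_im, abs_neg]
      exact hu k j h
  have hwne : ∀ j k, j ≠ k → w j - w k ≠ 0 := fun j k hne => by
    rw [hwd]
    exact div_ne_zero (abs_pos.1 (hu' j k hne).1) hl0.ne'
  have hw2 : ∀ j k, |w j - w k| < 2 := fun j k => by
    rcases eq_or_ne j k with rfl | hne
    · simp
    · rw [hwd, abs_div, abs_of_pos hl0, div_lt_iff₀ hl0]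
      exact (hu' j k hne).2
  obtain ⟨hpos, heq⟩ := hexact y w hyinj (fun j k hne => sub_ne_zero.1 (hwne j k hne)) hw2
  have hsin : ∀ j k, Real.sin (-(Real.pi * (w j - w k) / 2)) =
      Real.sin (Real.pi * (u k - u j).im / (2 * lam.re)) := fun j k => by
    rw [hwd, ← neg_sub (u k), Complex.neg_im]
    congr 1
    field_simp
  -- Each `tanhLaplace` is paired with its sine, so that P ≤ q uniformly in u; the compensating
  -- sines form part of `boundDenom`.
  set P := ∏ j, ∏ k ∈ Finset.Ioi j,
    (tanhLaplace (w j - w k) * Real.sin (-(Real.pi * (w j - w k) / 2))) with hP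
  have hmem : ∀ j k : Fin (n + 1), k ∈ Finset.Ioi j →
      tanhLaplace (w j - w k) * Real.sin (-(Real.pi * (w j - w k) / 2)) ∈
        Set.Icc 0 (2 * Real.pi) := fun j k hk =>
    tanhLaplace_mul_sin_mem (hwne j k (Finset.mem_Ioi.1 hk).ne) (hw2 j k)
  have hP0 : 0 ≤ P := Finset.prod_nonneg fun j _ => Finset.prod_nonneg fun k hk => (hmem j k hk).1
  have hPq : P ≤ q := Finset.prod_le_prod
    (fun j _ => Finset.prod_nonneg fun k hk => (hmem j k hk).1) fun j _ =>
    Finset.prod_le_prod (fun k hk => (hmem j k hk).1) fun k hk => (hmem j k hk).2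
  have hsinne : ∏ j, ∏ k ∈ Finset.Ioi j,
      Real.sin (Real.pi * (u k - u j).im / (2 * lam.re)) ≠ 0 := by
    refine Finset.prod_ne_zero_iff.2 fun j _ => Finset.prod_ne_zero_iff.2 fun k hk => ?_
    have h1 := hwne j k (Finset.mem_Ioi.1 hk).ne
    have h2 := abs_lt.1 (hw2 j k)
    have hpi := Real.pi_pos
    rw [← hsin, Ne, Real.sin_eq_zero_iff_of_lt_of_lt (by nlinarith) (by nlinarith)]
    simpa [hpi.ne'] using h1
  have hR : b * (∏ j, ∏ k ∈ Finset.Ioi j, tanhLaplace (w j - w k)) * (expMatrix y w).det /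
      sinhProd y = b / p * P * (altSum t u / boundDenom lam t u) := by
    have e1 : sinhProd y = p * ∏ j, ∏ k ∈ Finset.Ioi j,
        Real.sinh (lam.re * (t j - t k).re) := by
      simp only [sinhProd, hyd, Finset.prod_mul_distrib, p]
    have e2 : boundDenom lam t u =
        (∏ j, ∏ k ∈ Finset.Ioi j, Real.sin (Real.pi * (u k - u j).im / (2 * lam.re))) *
        ∏ j, ∏ k ∈ Finset.Ioi j, Real.sinh (lam.re * (t j - t k).re) := by
      simp only [boundDenom, Finset.prod_mul_distrib]
    have e3 : ∏ j, ∏ k ∈ Finset.Ioi j, Real.sinh (lam.re * (t j - t k).re) ≠ 0 := by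
      have := sinhProd_ne_zero hyinj
      rw [e1] at this
      exact right_ne_zero_of_mul this
    rw [hP]
    simp only [hsin, Finset.prod_mul_distrib (g := fun k => Real.sin _)]
    rw [Finset.prod_mul_distrib, e1, e2, altSum_eq_det hl0.ne' t u, ← hy, ← hw]
    generalize ∏ j, ∏ k ∈ Finset.Ioi j, Real.sin (Real.pi * (u k - u j).im / (2 * lam.re)) = S
      at hsinne ⊢
    generalize ∏ j, ∏ k ∈ Finset.Ioi j, Real.sinh (lam.re * (t j - t k).re) = T at e3 ⊢
    field_simp
  rw [hR] at hpos heq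
  -- The ratio inherits its sign from the positive closed form, as the other factor b / p * P is
  -- nonnegative.
  have hratio : 0 < altSum t u / boundDenom lam t u :=
    pos_of_mul_pos_right hpos (by positivity)
  refine ⟨hratio, (hscale lam.re hl _ _).trans ?_⟩
  rw [← hy, ← hw, heq, ← ENNReal.ofReal_mul ha.le]
  refine ENNReal.ofReal_le_ofReal ?_
  rw [mul_assoc a]
  refine mul_le_mul_of_nonneg_left ?_ ha.le
  refine mul_le_mul_of_nonneg_right ?_ hratio.le
  exact mul_le_mul_of_nonneg_left hPq (by positivity)

/-- The bound on `F` by the alternating sum. -/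
theorem exists_norm_F_lt (n : ℕ) :
    ∃ C : ℂ → ℝ → ℝ,
      ContinuousOn (fun q : ℂ × ℝ => C q.1 q.2)
        ({lam : ℂ | 1 ≤ lam.re} ×ˢ Set.Ico 0 (Real.pi / 2)) ∧
      ∀ (lam : ℂ) (t u : Fin (n + 1) → ℂ), 1 ≤ lam.re → t ∈ reducedDomain (n + 1) →
        (∀ j k, j < k → (t j - t k).re ≠ 0) →
        (∀ j k, j < k → |(u j - u k).im| ∈ Set.Ioo 0 (2 * lam.re)) →
        ‖F (n + 1) lam t u‖ < C lam (maxIm t) *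
          Real.exp (-(((n + 1 : ℕ) : ℝ) * (mean t * mean u).im)) *
            (altSum t u / boundDenom lam t u) := by
  obtain ⟨c, hc, h⟩ := exists_majorant_le_altSum_div n
  -- The ratio multiplying C is positive, so the added 1 makes the inequality strict.
  refine ⟨fun lam μ => kernelFactor n lam μ * c + 1,
    ((continuousOn_kernelFactor n).mul continuousOn_const).add continuousOn_const,
    fun lam t u hl ht htr hu => ?_⟩
  obtain ⟨hpos, hle⟩ := h lam t u hl htr hu
  have hμ : maxIm t ∈ Set.Ico 0 (Real.pi / 2) :=
    ⟨(abs_nonneg _).trans (abs_relative_im_le t 0), ht⟩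
  have hk := kernelFactor_nonneg n lam hμ
  have hext : (lam, t, u) ∈ extDomain (n + 1) := by
    refine ⟨hl, ht, fun j k => ?_⟩
    rcases lt_trichotomy j k with hjk | rfl | hjk
    · exact (hu j k hjk).2
    · simp only [sub_self, Complex.zero_im, abs_zero]
      positivity
    · rw [← neg_sub, Complex.neg_im, abs_neg]
      exact (hu k j hjk).2
  have hred : ‖reducedF lam t u‖ ≤
      kernelFactor n lam (maxIm t) * (c * (altSum t u / boundDenom lam t u)) := by
    have := (norm_reducedF_le (u := u) (zero_lt_one.trans_le hl) ht).trans (mul_le_mul_right hle _)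
    rwa [← ENNReal.ofReal_mul hk, ← ofReal_norm, ENNReal.ofReal_le_ofReal_iff (by positivity)]
      at this
  have hexp : ‖Complex.exp (Complex.I * ((n + 1 : ℕ) : ℂ) * mean t * mean u)‖ =
      Real.exp (-(((n + 1 : ℕ) : ℝ) * (mean t * mean u).im)) := by
    rw [Complex.norm_exp]
    congr 1
    rw [show Complex.I * ((n + 1 : ℕ) : ℂ) * mean t * mean u =
      Complex.I * (((n + 1 : ℕ) : ℝ) * (mean t * mean u)) by push_cast; ring, Complex.I_mul_re,
      Complex.im_ofReal_mul]
  rw [(regular n).F_succ_eq hext, norm_mul, hexp, mul_comm _ (Real.exp _), mul_assoc]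
  refine mul_lt_mul_of_pos_left (hred.trans_lt ?_) (Real.exp_pos _)
  linarith

end CalogeroMoser

end

theorem theorem6p4 (n : ℕ) :
    (∀ lam t u, (lam, t, u) ∈ CalogeroMoser.extDomain (n + 1) →
      MeasureTheory.Integrable (fun s : Fin n → ℝ =>
        CalogeroMoser.stepIntegrand (CalogeroMoser.F n lam) lam t u
          (CalogeroMoser.midHeight t) s) ∧
      MeasureTheory.Integrable (fun s : Fin n → ℝ =>
        CalogeroMoser.stepIntegrand (CalogeroMoser.F n lam) lam
          (CalogeroMoser.relative t) u 0 s) ∧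
      CalogeroMoser.F (n + 1) lam t u =
        Complex.exp (Complex.I * ((n + 1 : ℕ) : ℂ) *
          CalogeroMoser.mean t * CalogeroMoser.mean u) *
          CalogeroMoser.reducedF lam t u) ∧
    DifferentiableOn ℂ
      (fun p : ℂ × (Fin (n + 1) → ℂ) × (Fin (n + 1) → ℂ) =>
        CalogeroMoser.F (n + 1) p.1 p.2.1 p.2.2)
      (CalogeroMoser.holoDomain (n + 1)) ∧
    ContinuousOn
      (fun p : ℂ × (Fin (n + 1) → ℂ) × (Fin (n + 1) → ℂ) =>
        CalogeroMoser.F (n + 1) p.1 p.2.1 p.2.2)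
      (CalogeroMoser.extDomain (n + 1)) ∧
    ∃ C : ℂ → ℝ → ℝ,
      ContinuousOn (fun q : ℂ × ℝ => C q.1 q.2)
        ({lam : ℂ | 1 ≤ lam.re} ×ˢ Set.Ico 0 (Real.pi / 2)) ∧
      ∀ (lam : ℂ) (t u : Fin (n + 1) → ℂ),
        1 ≤ lam.re →
        t ∈ CalogeroMoser.reducedDomain (n + 1) →
        (∀ j k, j < k → (t j - t k).re ≠ 0) →
        (∀ j k, j < k → |(u j - u k).im| ∈ Set.Ioo 0 (2 * lam.re)) →
        ‖CalogeroMoser.F (n + 1) lam t u‖ <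
          C lam (CalogeroMoser.maxIm t) *
            Real.exp (-(((n + 1 : ℕ) : ℝ) *
              (CalogeroMoser.mean t * CalogeroMoser.mean u).im)) *
            (CalogeroMoser.altSum t u / CalogeroMoser.boundDenom lam t u) := by
  refine ⟨fun lam t u hp => ⟨?_, ?_, ?_⟩, ?_, ?_, ?_⟩
  · exact (CalogeroMoser.regular n).integrable_midHeight hp
  · exact (CalogeroMoser.regular n).integrable_stepIntegrand
      (p := (lam, CalogeroMoser.relative t, u))
      (CalogeroMoser.relative_mem_realContourDomain (p := (lam, t, u)) hp)
  · exact (CalogeroMoser.regular n).F_succ_eq hp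
  · exact (CalogeroMoser.regular (n + 1)).2
  · exact (CalogeroMoser.regular (n + 1)).1
  · exact CalogeroMoser.exists_norm_F_lt n
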